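/- **Setting.** Let $n\ge 1$, $p\ge 3$, $q\ge 1$, $L\ge 1$ be integers and let $\mathbf X\in[-1,1]^{n\times p}$ be a fixed matrix with exactly $q$ non-zero entries in each row; write $\mathbf z_i=\{k: X_{ik}\ne 0\}$. Let $\boldsymbol\theta\in\mathbb R^p$ and let $\boldsymbol\Theta\in\mathbb R^{p\times p}$ have zero diagonal; $\boldsymbol\Theta^*$ denotes the pair $(\boldsymbol\theta,\boldsymbol\Theta)$. Put $$f_i^*=\sum_{k}X_{ik}\theta_k+\sum_{k,k_1}X_{ik}\mathbb 1_{\{X_{ik_1}=0\}}\Theta_{kk_1},\qquad \ell(\boldsymbol\Theta^*)=\|\boldsymbol\theta\|_2+\Big(2(2-q/p)q\sum_{k,k_1,k_2}|\Theta_{kk_1}\Theta_{kk_2}|\Big)^{1/2}.$$ Let $\boldsymbol\gamma\in\mathbb R^n$ be deterministic (structural error), and let $Y_1,\dots,Y_n$ be independent with $Y_i\sim\mathrm{Bernoulli}(p_i)$, where $\log\{p_i/(1-p_i)\}=f_i^*+\gamma_i$. Let $\pi_1,\dots,\pi_L$ be independent uniform random permutations of $\{1,\dots,p\}$ and let $\Psi_{kl}$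 ($1\le k\le p$, $1\le l\le L$) be independent uniform signs in $\{-1,1\}$; permutations, signs and labels are all independent. Random-sign min-wise hashing produces the matrix $\mathbf S\in\mathbb R^{n\times L}$ with $S_{il}=\Psi_{H_{il}l}X_{iH_{il}}$, where $H_{il}=\operatorname{argmin}_{k\in\mathbf z_i}\pi_l(k)$; $\mathbf s_i$ is its $i$-th row. For $\eta>0$ and $c\in\{1,2\}$ let $\hat{\mathbf b}$ be a (measurable) minimiser of $$\frac1n\sum_{i=1}^n\big[-Y_i\mathbf s_i^T\mathbf b+\log\{1+\exp(\mathbf s_i^T\mathbf b)\}\big]\quad\text{subject to}\quad\|\mathbf b\|_2^2\le(1+\eta)\frac{c\,(2-q/p)q\,\ell^2(\boldsymbol\Theta^*)}{L},$$ and define its excess risk by $$\mathcal E(\hat{\mathbf b})=\frac1n\sum_{i=1}^n\big[-p_i\mathbf s_i^T\hat{\mathbf b}+\log\{1+\exp(\mathbf s_i^T\hat{\mathbf b})\}\big]-\frac1n\sum_{i=1}^n\big[-p_i(f_i^*+\gamma_i)+\log\{1+\exp(f_i^*+\gamma_i)\}\big].$$ Let $\delta=q/p$, $\tilde p=\frac1n\sum_i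 p_i(1-p_i)$, $L^*=\sqrt{(2-q/p)qn}\,\ell(\boldsymbol\Theta^*)$ and $$\rho_2=\exp\Big(-\frac{L\eta^2}{2(2-\delta)(3+2\eta)q}\Big)+\exp\Big(-\frac{L\eta^2}{4(2-\delta)^2(3+2\eta)q^2}\Big).$$ **Theorem (logistic regression for interaction models).** The excess risk $\mathcal E(\hat{\mathbf b})$ is integrable, and the following bounds hold. (a) For the constraint with $c=2$, $$\mathbb E_{\mathbf Y,\boldsymbol\pi,\boldsymbol\Psi}\{\mathcal E(\hat{\mathbf b})\}\le\sqrt{(2-q/p)q}\;\ell(\boldsymbol\Theta^*)\,\frac{\sqrt2\sqrt{(1+\eta)\tilde p}+L^*/(4L)}{\sqrt n}+\frac{\|\boldsymbol\gamma\|_2^2}{4n}+\log(2)\rho_2.$$ (b) For the constraint with $c=1$, $$\mathbb E_{\mathbf Y,\boldsymbol\pi,\boldsymbol\Psi}\{\mathcal E(\hat{\mathbf b})\}\le\sqrt{(2-q/p)q}\;\ell(\boldsymbol\Theta^*)\,\frac{\sqrt{(1+\eta)\tilde p}+\sqrt2L^*/(4L)}{\sqrt n}+\frac{\|\boldsymbol\gamma\|_2^2}{4n}+\log(2)\rho_2.$$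 In particular, if $\boldsymbol\gamma=\mathbf 0$ the term $\|\boldsymbol\gamma\|_2^2/(4n)$ disappears. -/

import Mathlib

open MeasureTheory

namespace MinwiseHashing

/-- `z_i`, the set of (indices of) non-zero entries of the `i`-th row of the design matrix. -/
noncomputable def rowSupport {n p : ℕ} (X : Matrix (Fin n) (Fin p) ℝ) (i : Fin n) :
    Finset (Fin p) :=
  Finset.univ.filter fun k => X i k ≠ 0

/-- The min-wise hash value `H_i = argmin_{k ∈ z_i} σ(k)` of a row with at least one non-zero
entry: the variable of smallest rank under the permutation `σ`. -/
noncomputable def hashIndex {n p : ℕ} (X : Matrix (Fin n) (Fin p) ℝ) (σ : Equiv.Perm (Fin p))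
    (i : Fin n) (h : (rowSupport X i).Nonempty) : Fin p :=
  σ.symm (((rowSupport X i).image σ).min' (h.image σ))

open Classical in
/-- The compressed matrix of random-sign min-wise hashing, `S_{il} = Ψ_{H_{il} l} X_{i H_{il}}`,
from permutations `π_1, …, π_L` and signs `Ψ ∈ {-1,1}^{p × L}` (an identically zero row is mapped
to zero). -/
noncomputable def signHash {n p L : ℕ} (X : Matrix (Fin n) (Fin p) ℝ)
    (π : Fin L → Equiv.Perm (Fin p)) (Ψ : Fin p → Fin L → ℤˣ) : Matrix (Fin n) (Fin L) ℝ :=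
  fun i l =>
    if h : (rowSupport X i).Nonempty then
      ((Ψ (hashIndex X (π l) i h) l : ℤ) : ℝ) * X i (hashIndex X (π l) i h)
    else 0

open Classical in
/-- The interaction signal
`f_i = ∑_k X_{ik} θ_k + ∑_{k,k₁} X_{ik} 1{X_{ik₁} = 0} Θ_{k k₁}`. -/
noncomputable def interactionSignal {n p : ℕ} (X : Matrix (Fin n) (Fin p) ℝ)
    (θ : EuclideanSpace ℝ (Fin p)) (Θ : Matrix (Fin p) (Fin p) ℝ) (i : Fin n) : ℝ :=
  ∑ k, X i k * θ k + ∑ k, ∑ k₁, X i k * (if X i k₁ = 0 then 1 else 0) * Θ k k₁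

/-- The size `ℓ(Θ)` of the coefficients of an interaction model with `q` non-zero entries
in each row. -/
noncomputable def interactionNorm {p : ℕ} (q : ℕ) (θ : EuclideanSpace ℝ (Fin p))
    (Θ : Matrix (Fin p) (Fin p) ℝ) : ℝ :=
  ‖θ‖ + Real.sqrt (2 * (2 - (q : ℝ) / p) * q * ∑ k, ∑ k₁, ∑ k₂, |Θ k k₁ * Θ k k₂|)

/-- `L* = √((2 - q/p) q n) ℓ(Θ) / σ` with noise level `σ = 1`. -/
noncomputable def Lstar {p : ℕ} (n q : ℕ) (θ : EuclideanSpace ℝ (Fin p))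
    (Θ : Matrix (Fin p) (Fin p) ℝ) : ℝ :=
  Real.sqrt ((2 - (q : ℝ) / p) * q * n) * interactionNorm q θ Θ

/-- The tail term `ρ₂`, with `δ = q / p`. -/
noncomputable def rho2 (p q L : ℕ) (η : ℝ) : ℝ :=
  Real.exp (-(L * η ^ 2 / (2 * (2 - (q : ℝ) / p) * (3 + 2 * η) * q))) +
    Real.exp (-(L * η ^ 2 / (4 * (2 - (q : ℝ) / p) ^ 2 * (3 + 2 * η) * (q : ℝ) ^ 2)))

/-- The average logistic loss `(1/n) ∑_i [-c_i t_i + log(1 + exp t_i)]` of the linear predictor `t`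
for the responses (or the success probabilities) `c`. -/
noncomputable def logisticLoss {n : ℕ} (c t : Fin n → ℝ) : ℝ :=
  (1 / (n : ℝ)) * ∑ i, (-(c i) * t i + Real.log (1 + Real.exp (t i)))

/-- A class label as a real number in `{0, 1}`. -/
def label (y : Bool) : ℝ := if y then 1 else 0

/-- `b` is a minimiser of the empirical logistic loss on `S` subject to `‖b‖₂² ≤ r`. -/
def IsConstrainedLogistic {n L : ℕ} (S : Matrix (Fin n) (Fin L) ℝ) (y : Fin n → Bool) (r : ℝ)
    (b : EuclideanSpace ℝ (Fin L)) : Prop :=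
  ‖b‖ ^ 2 ≤ r ∧ ∀ b' : EuclideanSpace ℝ (Fin L), ‖b'‖ ^ 2 ≤ r →
    logisticLoss (fun i => label (y i)) (S.mulVec b.ofLp) ≤
      logisticLoss (fun i => label (y i)) (S.mulVec b'.ofLp)

/-- Excess risk of `b` under logistic loss: `pr` are the success probabilities and `g` their true
log-odds. -/
noncomputable def excessRisk {n L : ℕ} (S : Matrix (Fin n) (Fin L) ℝ) (pr g : Fin n → ℝ)
    (b : EuclideanSpace ℝ (Fin L)) : ℝ :=
  logisticLoss pr (S.mulVec b.ofLp) - logisticLoss pr g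

/-- The joint distribution of the permutations, the signs and the labels. Their joint probability
mass function is the product of the marginal ones: the `L` permutations are uniform on the
permutations of `{1, …, p}`, the `p * L` signs are uniform on `{-1, 1}`, the label `Y_i` is
Bernoulli with success probability `pr i`, and all these variables are independent. -/
structure IsHashedBernoulliSample {Ω : Type*} [MeasurableSpace Ω] (P : Measure Ω) {n p L : ℕ}
    (pr : Fin n → ℝ) (π : Ω → Fin L → Equiv.Perm (Fin p)) (Ψ : Ω → Fin p → Fin L → ℤˣ)
    (Y : Ω → Fin n → Bool) : Prop where
  measurableSet_eq : ∀ σ s y, MeasurableSet {ω | π ω = σ ∧ Ψ ω = s ∧ Y ω = y}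
  law : ∀ σ s y, P.real {ω | π ω = σ ∧ Ψ ω = s ∧ Y ω = y} =
    (∏ _l : Fin L, 1 / (Nat.factorial p : ℝ)) * (∏ _k : Fin p, ∏ _l : Fin L, (1 / 2 : ℝ)) *
      ∏ i, (if y i then pr i else 1 - pr i)

end MinwiseHashing

/-! The compressed matrix carries a good predictor of its own. Give column `l` the coefficient
`(1/L) ∑ k, Ψ_kl w_k(π_l)`, where `w_k(π)` depends on the rank of `k` and on those `Θ_kk₁` for which
`k₁` ranks before `k`. After multiplication by `S_il`, averaging over the signs keeps only `k =
H_il`. Every variable ranked before `H_il` vanishes in row `i`, so comparing ranks detects the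
indicator of `X_ik₁ = 0`. Suitable rank weights make this oracle exactly unbiased for the signal
(`hashEntry_mean`), and inequalities for sums of squared binomials bound its second moments through
`(2 - q/p) q ℓ²` (`coef_sq_mean_le`).

Independence of the columns turns this into a mean squared error of at most `(2 - q/p) q ℓ² / L`
(`oracle_mean_sq_error`). A Bernstein bound for squared Rademacher sums (`rademacher_sq_tail`) shows
that the oracle leaves the smaller ball, `c = 1`, with probability at most `ρ₂`
(`oracle_norm_tail`).

By Hoeffding's lemma the logistic excess risk is at most an eighth of the squared error in log-odds.
This yields the approximation term and the `γ` term; outside the ball the oracle is replaced by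
zero, whose excess risk is at most `log 2` (`truncOracle_excessRisk_mean_le`). Minimality and
Cauchy–Schwarz leave a noise term `√r ‖Sᵀ(Y - p)‖ / n`, controlled by the second moment of the score
(`riskBound_mean_le`).

Permutations, signs and labels take finitely many values, so expectations are computed as weighted
finite sums; `integral_samplePair` carries them over to `P`. -/

namespace MinwiseHashing

/-! ### Expectations under finite product weights. -/

section ProductWeights

variable {ι α : Type*} [Fintype ι] [DecidableEq ι] [Fintype α]

theorem sum_pi_prod (f : ι → α → ℝ) :
    ∑ y : ι → α, ∏ j, f j (y j) = ∏ j, ∑ a, f j a := by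
  classical
  rw [Finset.prod_univ_sum, Fintype.piFinset_univ]

theorem pi_expect_eval {μ : ι → α → ℝ} (hμ : ∀ j, ∑ a, μ j a = 1) (i : ι) (g : α → ℝ) :
    ∑ y : ι → α, (∏ j, μ j (y j)) * g (y i) = ∑ a, μ i a * g a := by
  have h (y : ι → α) : (∏ j, μ j (y j)) * g (y i) =
      ∏ j, (μ j (y j) * if j = i then g (y j) else 1) := by
    rw [Finset.prod_mul_distrib, Finset.prod_ite_eq' Finset.univ i]; simp
  simp_rw [h]
  rw [sum_pi_prod (fun j a => μ j a * if j = i then g a else 1),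
    Finset.prod_eq_single i]
  · simp
  · intro j _ hj; simp [hj, hμ]
  · simp

theorem pi_expect_eval_mul {μ : ι → α → ℝ} (hμ : ∀ j, ∑ a, μ j a = 1) {i k : ι} (hik : i ≠ k)
    (g h : α → ℝ) :
    ∑ y : ι → α, (∏ j, μ j (y j)) * (g (y i) * h (y k)) =
      (∑ a, μ i a * g a) * ∑ a, μ k a * h a := by
  have e (y : ι → α) : (∏ j, μ j (y j)) * (g (y i) * h (y k)) =
      ∏ j, (μ j (y j) * ((if j = i then g (y j) else 1) * if j = k then h (y j) else 1)) := by
    rw [Finset.prod_mul_distrib, Finset.prod_mul_distrib, Finset.prod_ite_eq' Finset.univ i,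
      Finset.prod_ite_eq' Finset.univ k]; simp
  simp_rw [e]
  rw [sum_pi_prod (fun j a => μ j a * ((if j = i then g a else 1) * if j = k then h a else 1)),
    Finset.prod_eq_mul i k hik]
  · simp [hik, hik.symm]
  · rintro j - ⟨hji, hjk⟩; simp [hji, hjk, hμ]
  · simp
  · simp

/-- The second moment of a sum of independent centred variables. -/
theorem pi_expect_sum_sq {μ g : ι → α → ℝ} (hμ : ∀ j, ∑ a, μ j a = 1)
    (hg : ∀ j, ∑ a, μ j a * g j a = 0) :
    ∑ y : ι → α, (∏ j, μ j (y j)) * (∑ j, g j (y j)) ^ 2 = ∑ j, ∑ a, μ j a * g j a ^ 2 := by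
  simp_rw [sq, Finset.sum_mul_sum, Finset.mul_sum]
  rw [Finset.sum_comm]
  refine Finset.sum_congr rfl fun i _ => ?_
  rw [Finset.sum_comm, Finset.sum_eq_single i]
  · exact pi_expect_eval hμ i fun a => g i a * g i a
  · intro k _ hk
    rw [pi_expect_eval_mul hμ hk.symm, hg, zero_mul]
  · simp

theorem pi_expect_sum {μ g : ι → α → ℝ} (hμ : ∀ j, ∑ a, μ j a = 1) :
    ∑ y : ι → α, (∏ j, μ j (y j)) * (∑ j, g j (y j)) = ∑ j, ∑ a, μ j a * g j a := by
  simp_rw [Finset.mul_sum]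
  rw [Finset.sum_comm]
  exact Finset.sum_congr rfl fun i _ => pi_expect_eval hμ i (g i)

theorem pi_weight_sum {μ : ι → α → ℝ} (hμ : ∀ j, ∑ a, μ j a = 1) :
    ∑ y : ι → α, ∏ j, μ j (y j) = 1 := by
  rw [sum_pi_prod, Finset.prod_eq_one fun j _ => hμ j]

end ProductWeights

/-! ### Order events of a uniform permutation. -/

section Permutations

variable {p : ℕ}

/-- Exchangeability of the values of a uniform permutation outside `D`. -/
theorem card_mul_sum_perm_eq {D : Finset (Fin p)} {G : Equiv.Perm (Fin p) → Fin p → ℝ} {j : Fin p}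
    (hG : ∀ σ, ∀ j' ∉ D, G (σ * Equiv.swap j j') j = G σ j') :
    ((p : ℝ) - D.card) * ∑ σ, G σ j = ∑ σ, ∑ j' ∈ Dᶜ, G σ j' := by
  rw [Finset.sum_comm]
  have h : ∀ j' ∈ Dᶜ, ∑ σ, G σ j' = ∑ σ, G σ j := by
    intro j' hj'
    rw [← Equiv.sum_comp (Equiv.mulRight (Equiv.swap j j')) fun σ => G σ j]
    exact Finset.sum_congr rfl fun σ _ => (hG σ j' (by simpa using hj')).symm
  rw [Finset.sum_congr rfl h, Finset.sum_const, Finset.card_compl, nsmul_eq_mul, Fintype.card_fin,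
    Nat.cast_sub (by simpa using Finset.card_le_univ D)]

theorem sum_perm_apply (k : Fin p) (w : Fin p → ℝ) :
    (p : ℝ) * ∑ σ : Equiv.Perm (Fin p), w (σ k) = (p.factorial : ℝ) * ∑ r, w r := by
  have h := card_mul_sum_perm_eq (D := ∅) (G := fun σ j => w (σ j)) (j := k)
    (by intro σ j' _; simp)
  simp only [Finset.card_empty, Nat.cast_zero, sub_zero, Finset.compl_empty] at h
  rw [h]
  simp_rw [fun σ : Equiv.Perm (Fin p) => Equiv.sum_comp σ w]
  simp [Fintype.card_perm]

/-- With `σ k` held fixed, `k₁` is exchangeable with all other indices, and exactly `σ k` of these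
rank below `k`. -/
theorem sum_perm_apply_lt {k k₁ : Fin p} (hk : k₁ ≠ k) (w : Fin p → ℝ) :
    ((p : ℝ) - 1) * ∑ σ : Equiv.Perm (Fin p), w (σ k) * (if σ k₁ < σ k then 1 else 0) =
      ∑ σ : Equiv.Perm (Fin p), w (σ k) * (σ k : ℕ) := by
  have h := card_mul_sum_perm_eq (D := {k})
    (G := fun σ j => w (σ k) * (if σ j < σ k then 1 else 0)) (j := k₁) (by
      intro σ j' hj'
      have : Equiv.swap k₁ j' k = k :=
        Equiv.swap_apply_of_ne_of_ne hk.symm fun h => hj' (by simp [h])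
      simp [this])
  simp only [Finset.card_singleton, Nat.cast_one] at h
  rw [h]
  refine Finset.sum_congr rfl fun σ _ => ?_
  rw [← Finset.mul_sum, Finset.sum_boole]
  congr 2
  rw [← Fin.card_Iio (σ k), ← Finset.card_map σ.toEmbedding]
  congr 1
  ext r
  simp only [Finset.mem_map, Finset.mem_filter, Finset.mem_compl, Finset.mem_singleton,
    Equiv.coe_toEmbedding, Finset.mem_Iio]
  constructor
  · rintro ⟨j, ⟨-, hj⟩, rfl⟩; exact hj
  · intro hr
    refine ⟨σ.symm r, ⟨?_, by simpa using hr⟩, by simp⟩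
    rintro rfl; simp at hr

/-- Probability that a uniform permutation ranks `k` below all of `A`, given the values that the
weight `F` depends on. -/
theorem sum_perm_mul_forall_lt {D : Finset (Fin p)} {k : Fin p} (hk : k ∈ D)
    {F : Equiv.Perm (Fin p) → ℝ}
    (hF : ∀ σ, ∀ j ∉ D, ∀ j' ∉ D, F (σ * Equiv.swap j j') = F σ)
    (hD : ∀ σ, F σ ≠ 0 → ∀ d ∈ D, σ d ≤ σ k)
    (A : Finset (Fin p)) (hA : Disjoint D A) :
    ∑ σ, F σ * (if ∀ j ∈ A, σ k < σ j then 1 else 0) =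
      ∑ σ, F σ * (((p - 1 - (σ k : ℕ)).choose A.card : ℝ) / ((p - D.card).choose A.card : ℝ)) := by
  induction A using Finset.induction_on generalizing F with
  | empty => simp
  | insert j A hjA ih =>
    have hjD : j ∉ D := fun h => Finset.disjoint_left.1 hA h (Finset.mem_insert_self _ _)
    have hA' : Disjoint D A := Finset.disjoint_of_subset_right (Finset.subset_insert _ _) hA
    have hcard : (D ∪ A).card = D.card + A.card := Finset.card_union_of_disjoint hA'
    have hlt : D.card + A.card < p := by
      have := Finset.card_le_univ (insert j (D ∪ A))
      rw [Finset.card_insert_of_notMem (by simp [hjD, hjA]), hcard, Fintype.card_fin] at this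
      omega
    -- The new index `j` is exchangeable with everything outside `D ∪ A`, so its event can be
    -- replaced by a count of the indices there that rank above `k`.
    have hstep := card_mul_sum_perm_eq (D := D ∪ A) (j := j)
      (G := fun σ j' => F σ * (if ∀ i ∈ A, σ k < σ i then 1 else 0) *
        (if σ k < σ j' then 1 else 0)) (by
        intro σ j' hj'
        simp only [Finset.mem_union, not_or] at hj'
        have hfix : ∀ i ∈ D ∪ A, Equiv.swap j j' i = i := by
          intro i hi
          refine Equiv.swap_apply_of_ne_of_ne ?_ ?_ <;> rintro rfl <;> simp_all
        have h1 : (∀ i ∈ A, (σ * Equiv.swap j j') k < (σ * Equiv.swap j j') i) ↔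
            ∀ i ∈ A, σ k < σ i := by
          refine forall₂_congr fun i hi => ?_
          simp [hfix i (by simp [hi]), hfix k (by simp [hk])]
        simp only [hF σ j hjD j' hj'.1, h1]
        simp [hfix k (by simp [hk])])
    have hcount : ∀ σ : Equiv.Perm (Fin p), ∑ j' ∈ (D ∪ A)ᶜ,
        F σ * (if ∀ i ∈ A, σ k < σ i then 1 else 0) * (if σ k < σ j' then (1 : ℝ) else 0) =
        (F σ * ((p : ℝ) - 1 - (σ k : ℕ) - A.card)) *
          (if ∀ i ∈ A, σ k < σ i then 1 else 0) := by
      intro σ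
      rw [← Finset.mul_sum, Finset.sum_boole]
      by_cases hFσ : F σ = 0
      · simp [hFσ]
      by_cases hall : ∀ i ∈ A, σ k < σ i
      swap
      · simp [hall]
      simp only [if_pos hall, mul_one]
      congr 1
      -- The ranks above `σ k` are shared between `A` and the counted indices; `D` takes none of
      -- them by `hD`. Hence the count depends on `σ k` alone.
      have himg : (((D ∪ A)ᶜ.filter fun j' => σ k < σ j') ∪ A).map σ.toEmbedding =
          Finset.Ioi (σ k) := by
        ext r
        simp only [Finset.mem_map, Finset.mem_filter, Finset.mem_compl, Finset.mem_union, not_or,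
          Equiv.coe_toEmbedding, Finset.mem_Ioi]
        constructor
        · rintro ⟨i, ⟨_, hi⟩ | hi, rfl⟩
          exacts [hi, hall i hi]
        · intro hr
          refine ⟨σ.symm r, ?_, by simp⟩
          by_cases hrA : σ.symm r ∈ A
          · exact Or.inr hrA
          · refine Or.inl ⟨⟨fun hrD => ?_, hrA⟩, by simpa using hr⟩
            have := hD σ hFσ _ hrD
            simp only [Equiv.apply_symm_apply] at this
            exact absurd hr (not_lt.2 this)
      have hc := congrArg Finset.card himg
      rw [Finset.card_map, Finset.card_union_of_disjoint, Fin.card_Ioi] at hc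
      · have hσ := (σ k).isLt
        have hc' : ((((D ∪ A)ᶜ.filter fun j' => σ k < σ j').card : ℕ) : ℝ) + A.card + 1 + (σ k : ℕ)
            = p := by
          norm_cast; omega
        linarith
      · rw [Finset.disjoint_left]
        intro i hi hiA
        simp [hiA] at hi
    -- The count is absorbed into the weight; as a function of `σ k` it preserves the invariance and
    -- the condition on `D`. This is why the induction runs over all `F`.
    rw [Finset.sum_congr rfl fun σ _ => hcount σ, ih (F := fun σ => F σ *
        ((p : ℝ) - 1 - (σ k : ℕ) - A.card))] at hstep
    · have hpos : (0 : ℝ) < (p : ℝ) - (D ∪ A).card := by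
        rw [hcard, sub_pos]; exact_mod_cast hlt
      have hsplit : ∀ σ : Equiv.Perm (Fin p), F σ * (if ∀ i ∈ insert j A, σ k < σ i then 1 else 0)
          = F σ * (if ∀ i ∈ A, σ k < σ i then 1 else 0) * (if σ k < σ j then 1 else 0) := by
        intro σ
        simp only [Finset.forall_mem_insert]
        by_cases h1 : σ k < σ j <;> by_cases h2 : ∀ i ∈ A, σ k < σ i <;> simp [h1, h2]
      rw [Finset.sum_congr rfl fun σ _ => hsplit σ]
      apply mul_left_cancel₀ hpos.ne'
      rw [hstep, Finset.mul_sum]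
      refine Finset.sum_congr rfl fun σ _ => ?_
      rw [Finset.card_insert_of_notMem hjA, hcard]
      have hσ := (σ k).isLt
      have e1 : ((p - 1 - (σ k : ℕ)).choose (A.card + 1) : ℝ) * (A.card + 1) =
          (p - 1 - (σ k : ℕ)).choose A.card * ((p : ℝ) - 1 - (σ k : ℕ) - A.card) := by
        have := Nat.choose_succ_right_eq (p - 1 - (σ k : ℕ)) A.card
        -- The real difference on the right can be negative, but then both binomials are zero.
        rcases le_or_gt A.card (p - 1 - (σ k : ℕ)) with h | h
        · have h2 : ((p - 1 - (σ k : ℕ) - A.card : ℕ) : ℝ) =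
              (p : ℝ) - 1 - (σ k : ℕ) - A.card := by
            have : p - 1 - (σ k : ℕ) - A.card + A.card + (σ k : ℕ) + 1 = p := by omega
            have : ((p - 1 - (σ k : ℕ) - A.card : ℕ) : ℝ) + A.card + (σ k : ℕ) + 1 = p := by
              exact_mod_cast this
            linarith
          rw [← h2]; exact_mod_cast this
        · rw [Nat.choose_eq_zero_of_lt h, Nat.choose_eq_zero_of_lt (by omega)]; simp
      have e2 : ((p - D.card).choose (A.card + 1) : ℝ) * (A.card + 1) =
          (p - D.card).choose A.card * ((p : ℝ) - (D.card + A.card : ℕ)) := by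
        have := Nat.choose_succ_right_eq (p - D.card) A.card
        have h2 : ((p - D.card - A.card : ℕ) : ℝ) = (p : ℝ) - (D.card + A.card : ℕ) := by
          rw [← Nat.cast_sub hlt.le]; congr 1; omega
        rw [← h2]; exact_mod_cast this
      have p1 : (0 : ℝ) < (p - D.card).choose (A.card + 1) := by
        exact_mod_cast Nat.choose_pos (by omega)
      have p2 : (0 : ℝ) < (p - D.card).choose A.card := by
        exact_mod_cast Nat.choose_pos (by omega)
      rw [mul_assoc, mul_left_comm ((p : ℝ) - (D.card + A.card : ℕ))]
      congr 1
      rw [mul_div_assoc', mul_div_assoc', div_eq_div_iff p2.ne' p1.ne']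
      have p3 : (0 : ℝ) < (A.card : ℝ) + 1 := by positivity
      apply mul_right_cancel₀ p3.ne'
      linear_combination (-1 : ℝ) * ((p - D.card).choose A.card : ℝ) *
          ((p : ℝ) - (D.card + A.card : ℕ)) * e1 +
        ((p - 1 - (σ k : ℕ)).choose A.card : ℝ) * ((p : ℝ) - 1 - (σ k : ℕ) - A.card) * e2
    · intro σ i hi i' hi'
      have : Equiv.swap i i' k = k := by
        refine Equiv.swap_apply_of_ne_of_ne ?_ ?_ <;> rintro rfl <;> contradiction
      simp [hF σ i hi i' hi', this]
    · intro σ hσ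
      exact hD σ (left_ne_zero_of_mul hσ)
    · exact hA'

end Permutations

/-! ### Inequalities for sums of squared binomials. -/

section Binomials

/-- `∑_{t < N} C(t, a)²` -/
def chooseSq (a N : ℕ) : ℝ := ∑ t ∈ Finset.range N, (t.choose a : ℝ) ^ 2

/-- `∑_{M < N} ∑_{t < M} C(t, a)²` -/
def chooseSqSum (a N : ℕ) : ℝ := ∑ M ∈ Finset.range N, chooseSq a M

theorem chooseSq_succ (a N : ℕ) : chooseSq a (N + 1) = chooseSq a N + (N.choose a : ℝ) ^ 2 :=
  Finset.sum_range_succ _ _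

theorem chooseSq_nonneg (a N : ℕ) : 0 ≤ chooseSq a N :=
  Finset.sum_nonneg fun _ _ => sq_nonneg _

theorem chooseSqSum_succ (a N : ℕ) : chooseSqSum a (N + 1) = chooseSqSum a N + chooseSq a N :=
  Finset.sum_range_succ _ _

/-- In the double sum, `t` occurs once for each `M` with `t < M < N`. In this form the sum appears
as a moment weighted by rank. -/
theorem chooseSqSum_eq (a N : ℕ) :
    chooseSqSum a N = ∑ t ∈ Finset.range N, ((N : ℝ) - 1 - t) * (t.choose a : ℝ) ^ 2 := by
  induction N with
  | zero => simp [chooseSqSum]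
  | succ N ih =>
    rw [chooseSqSum_succ, ih, Finset.sum_range_succ, chooseSq, ← Finset.sum_add_distrib]
    push_cast
    simp only [add_sub_cancel_right, sub_self, zero_mul, add_zero]
    exact Finset.sum_congr rfl fun t _ => by ring

theorem succ_mul_choose_cast (a N : ℕ) :
    ((N : ℝ) + 1) * N.choose a = (N + 1).choose (a + 1) * ((a : ℝ) + 1) := by
  exact_mod_cast Nat.add_one_mul_choose_eq N a

theorem choose_succ_cast (a N : ℕ) :
    ((N + 1).choose (a + 1) : ℝ) = N.choose a + N.choose (a + 1) := by
  exact_mod_cast Nat.choose_succ_succ N a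

/-- Equality holds at `N = a + 1`. At each step the left side grows by exactly the new summand times
the new prefactor, while on the right the prefactor of the old sum grows as well. With `N = p` and
`a + 1 = q` this is the source of `2 - q/p`. -/
theorem choose_sq_le_chooseSq (a N : ℕ) (hN : a + 1 ≤ N) :
    ((a : ℝ) + 1) * (N.choose (a + 1) : ℝ) ^ 2 ≤ (2 * N - (a + 1)) * chooseSq a N := by
  induction N, hN using Nat.le_induction with
  | base =>
    rw [chooseSq_succ]
    have := chooseSq_nonneg a a
    push_cast
    simp only [Nat.choose_self]
    nlinarith [(a.cast_nonneg : (0 : ℝ) ≤ a)]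
  | succ N hN ih =>
    have h1 := succ_mul_choose_cast a N
    have h2 := choose_succ_cast a N
    rw [chooseSq_succ]
    set c : ℝ := (N.choose a : ℝ)
    set T : ℝ := (N.choose (a + 1) : ℝ)
    set T' : ℝ := ((N + 1).choose (a + 1) : ℝ)
    have : ((a : ℝ) + 1) * T' ^ 2 = (a + 1) * T ^ 2 + c ^ 2 * (2 * (N + 1) - (a + 1)) := by
      have hT : T = T' - c := by linarith
      rw [hT]; linear_combination (-2 * c) * h1
    rw [this]
    push_cast
    nlinarith [chooseSq_nonneg a N]

/-- By Pascal's rule each product is half of a telescoping difference of squares plus a square. -/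
theorem sum_choose_mul_choose_succ (a N : ℕ) :
    ∑ M ∈ Finset.range N, (M.choose a : ℝ) * (M + 1).choose (a + 1) =
      ((N.choose (a + 1) : ℝ) ^ 2 + chooseSq a N) / 2 := by
  induction N with
  | zero => simp [chooseSq]
  | succ N ih =>
    rw [Finset.sum_range_succ, ih, chooseSq_succ, choose_succ_cast]; ring

/-- `choose_sq_le_chooseSq` is used twice: at every `M + 1` to bound the inner sums from below by
products of neighbouring binomials, and at `N` after these products have been summed. -/
theorem choose_sq_le_chooseSqSum (a N : ℕ) (hN : a + 1 ≤ N) :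
    (N : ℝ) ^ 2 * (N.choose (a + 1) : ℝ) ^ 2 ≤
      (2 * N - (a + 1)) ^ 2 * chooseSqSum a (N + 1) := by
  have hN' : (a : ℝ) + 1 ≤ N := by exact_mod_cast hN
  have ha : (0 : ℝ) ≤ a := a.cast_nonneg
  have key : ∀ M ∈ Finset.range N, (N : ℝ) * ((M.choose a : ℝ) * (M + 1).choose (a + 1)) ≤
      (2 * N - (a + 1)) * chooseSq a (M + 1) := by
    intro M hM
    have hMN : (M : ℝ) + 1 ≤ N := by exact_mod_cast Finset.mem_range.1 hM
    rcases lt_or_ge M a with h | h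
    · rw [Nat.choose_eq_zero_of_lt h]
      have := chooseSq_nonneg a (M + 1)
      have : (0 : ℝ) ≤ (2 * N - (a + 1)) := by linarith
      simp only [Nat.cast_zero, zero_mul, mul_zero]; positivity
    · have h1 := choose_sq_le_chooseSq a (M + 1) (by omega)
      have h2 := succ_mul_choose_cast a M
      push_cast at h1
      have hM' : (a : ℝ) ≤ M := by exact_mod_cast h
      set c : ℝ := (M.choose a : ℝ)
      set T : ℝ := ((M + 1).choose (a + 1) : ℝ)
      have hc : 0 ≤ c := Nat.cast_nonneg _
      have hT : 0 ≤ T := Nat.cast_nonneg _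
      have h3 : ((M : ℝ) + 1) * (c * T) ≤ (2 * (M + 1) - (a + 1)) * chooseSq a (M + 1) := by
        calc ((M : ℝ) + 1) * (c * T) = (a + 1) * T ^ 2 := by linear_combination T * h2
          _ ≤ _ := h1
      have hpos : (0 : ℝ) < 2 * (M + 1) - (a + 1) := by linarith
      -- The map `x ↦ x / (2x - (a + 1))` is decreasing, so the ratio at `M + 1` may be replaced by
      -- the one at `N`.
      have h4 : (N : ℝ) * (2 * (M + 1) - (a + 1)) ≤ (2 * N - (a + 1)) * (M + 1) := by nlinarith
      have hcT : 0 ≤ c * T := mul_nonneg hc hT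
      refine le_of_mul_le_mul_left ?_ hpos
      calc (2 * ((M : ℝ) + 1) - (a + 1)) * (N * (c * T))
          = (N * (2 * (M + 1) - (a + 1))) * (c * T) := by ring
        _ ≤ ((2 * N - (a + 1)) * (M + 1)) * (c * T) := by gcongr
        _ = (2 * N - (a + 1)) * ((M + 1) * (c * T)) := by ring
        _ ≤ (2 * N - (a + 1)) * ((2 * (M + 1) - (a + 1)) * chooseSq a (M + 1)) := by
          gcongr; linarith
        _ = _ := by ring
  have hsum := Finset.sum_le_sum key
  rw [← Finset.mul_sum, sum_choose_mul_choose_succ, ← Finset.mul_sum] at hsum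
  have hW : chooseSqSum a (N + 1) = ∑ M ∈ Finset.range N, chooseSq a (M + 1) := by
    rw [chooseSqSum, Finset.sum_range_succ']; simp [chooseSq]
  rw [← hW] at hsum
  have hV := choose_sq_le_chooseSq a N hN
  set T : ℝ := (N.choose (a + 1) : ℝ)
  have hpos : (0 : ℝ) ≤ 2 * N - (a + 1) := by linarith
  calc (N : ℝ) ^ 2 * T ^ 2 = N * ((2 * N - (a + 1)) * T ^ 2 + (a + 1) * T ^ 2) / 2 := by ring
    _ ≤ N * ((2 * N - (a + 1)) * T ^ 2 + (2 * N - (a + 1)) * chooseSq a N) / 2 := by gcongr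
    _ = (2 * N - (a + 1)) * (N * ((T ^ 2 + chooseSq a N) / 2)) := by ring
    _ ≤ (2 * N - (a + 1)) * ((2 * N - (a + 1)) * chooseSqSum a (N + 1)) := by gcongr
    _ = _ := by ring

end Binomials

/-! ### Moments and tails of Rademacher sums. -/

section Rademacher

open ProbabilityTheory

theorem sum_units_half (f : ℤˣ → ℝ) : ∑ e, (1 / 2 : ℝ) * f e = (f 1 + f (-1)) / 2 := by
  rw [← Finset.mul_sum, show (Finset.univ : Finset ℤˣ) = {1, -1} from rfl,
    Finset.sum_pair (by decide)]
  ring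

variable {κ : Type*} [Fintype κ] [DecidableEq κ]

theorem rademacher_sum_sq (b : κ → ℝ) :
    ∑ ψ : κ → ℤˣ, (∏ _k : κ, (1 / 2 : ℝ)) * (∑ k, ((ψ k : ℤ) : ℝ) * b k) ^ 2 =
      ∑ k, b k ^ 2 := by
  rw [pi_expect_sum_sq (μ := fun _ _ => 1 / 2) (g := fun k (e : ℤˣ) => ((e : ℤ) : ℝ) * b k)]
  · refine Finset.sum_congr rfl fun k _ => ?_
    rw [sum_units_half]; simp
  · intro _; simp
  · intro k; rw [sum_units_half]; simp

/-- Distinct signs are orthogonal, so the sign picked by the hash extracts its own coefficient. -/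
theorem rademacher_mul_sum (b : κ → ℝ) (h : κ) :
    ∑ ψ : κ → ℤˣ, (∏ _k : κ, (1 / 2 : ℝ)) * (((ψ h : ℤ) : ℝ) * ∑ k, ((ψ k : ℤ) : ℝ) * b k) =
      b h := by
  have hμ : ∀ _ : κ, ∑ _e : ℤˣ, (1 / 2 : ℝ) = 1 := by
    intro _; simp
  simp_rw [Finset.mul_sum]
  rw [Finset.sum_comm, Finset.sum_eq_single h]
  · rw [pi_expect_eval (μ := fun _ _ => 1 / 2) hμ h
      fun e : ℤˣ => ((e : ℤ) : ℝ) * (((e : ℤ) : ℝ) * b h), sum_units_half]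
    simp
  · intro k _ hk
    rw [pi_expect_eval_mul (μ := fun _ _ => 1 / 2) hμ hk.symm (fun e : ℤˣ => ((e : ℤ) : ℝ))
      fun e : ℤˣ => ((e : ℤ) : ℝ) * b k, sum_units_half]
    simp
  · simp

theorem integral_exp_mul_sq_gaussianReal {c : ℝ} (hc : 2 * c < 1) :
    Integrable (fun x => Real.exp (c * x ^ 2)) (gaussianReal 0 1) ∧
      ∫ x, Real.exp (c * x ^ 2) ∂(gaussianReal 0 1) = 1 / Real.sqrt (1 - 2 * c) := by
  have h (x : ℝ) : gaussianPDFReal 0 1 x * Real.exp (c * x ^ 2) =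
      (Real.sqrt (2 * Real.pi))⁻¹ * Real.exp (-(1 / 2 - c) * x ^ 2) := by
    rw [gaussianPDFReal_def]
    simp only [NNReal.coe_one, mul_one, sub_zero]
    rw [mul_assoc, ← Real.exp_add]
    congr 2; ring
  have hpos : 0 < 1 / 2 - c := by linarith
  constructor
  · rw [gaussianReal_of_var_ne_zero 0 one_ne_zero, gaussianPDF_def,
      integrable_withDensity_iff_integrable_smul₀' (by fun_prop) (by simp)]
    simp_rw [ENNReal.toReal_ofReal (gaussianPDFReal_nonneg _ _ _), smul_eq_mul, h]
    exact (integrable_exp_neg_mul_sq hpos).const_mul _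
  · rw [integral_gaussianReal_eq_integral_smul one_ne_zero]
    simp_rw [smul_eq_mul, h]
    rw [integral_const_mul, integral_gaussian, one_div (Real.sqrt (1 - 2 * c)), ← Real.sqrt_inv,
      ← Real.sqrt_inv, ← Real.sqrt_mul (by positivity)]
    congr 1
    have : 1 - 2 * c ≠ 0 := by linarith
    have := Real.pi_ne_zero
    field_simp

/-- A squared Rademacher sum is dominated in moment generating function by a squared Gaussian. -/
theorem rademacher_exp_sq_le (b : κ → ℝ) {lam : ℝ} (h0 : 0 ≤ lam)
    (h1 : 2 * (lam * ∑ k, b k ^ 2) < 1) :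
    ∑ ψ : κ → ℤˣ, (∏ _k : κ, (1 / 2 : ℝ)) *
      Real.exp (lam * (∑ k, ((ψ k : ℤ) : ℝ) * b k) ^ 2) ≤
        1 / Real.sqrt (1 - 2 * (lam * ∑ k, b k ^ 2)) := by
  -- Gaussian linearisation: `exp (lam x²)` is the mean of `exp (r x g)` for a standard normal `g`.
  -- The exponent is then linear in the signs, their mean factorises into hyperbolic cosines, and
  -- `cosh z ≤ exp (z² / 2)` applies to each.
  set r := Real.sqrt (2 * lam)
  have hr : r ^ 2 = 2 * lam := Real.sq_sqrt (by positivity)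
  have e1 (ψ : κ → ℤˣ) : Real.exp (lam * (∑ k, ((ψ k : ℤ) : ℝ) * b k) ^ 2) =
      ∫ x, Real.exp (r * (∑ k, ((ψ k : ℤ) : ℝ) * b k) * x) ∂(gaussianReal 0 1) := by
    have := congrFun (mgf_id_gaussianReal (μ := 0) (v := 1)) (r * ∑ k, ((ψ k : ℤ) : ℝ) * b k)
    simp only [mgf, id, zero_mul, zero_add, NNReal.coe_one, one_mul] at this
    rw [this, mul_pow, hr]
    congr 1; ring
  simp_rw [e1]
  obtain ⟨hi, hv⟩ := integral_exp_mul_sq_gaussianReal h1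
  rw [← hv]
  simp_rw [← integral_const_mul]
  have hint : ∀ ψ ∈ (Finset.univ : Finset (κ → ℤˣ)), Integrable (fun x => (∏ _k : κ, (1 / 2 : ℝ)) *
      Real.exp (r * (∑ k, ((ψ k : ℤ) : ℝ) * b k) * x)) (gaussianReal 0 1) := fun ψ _ =>
    (integrable_exp_mul_gaussianReal _).const_mul _
  rw [← integral_finsetSum _ hint]
  refine integral_mono (integrable_finsetSum _ hint) hi fun x => ?_
  have e2 (ψ : κ → ℤˣ) : (∏ _k : κ, (1 / 2 : ℝ)) *
      Real.exp (r * (∑ k, ((ψ k : ℤ) : ℝ) * b k) * x) =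
      ∏ k, (1 / 2 * Real.exp (((ψ k : ℤ) : ℝ) * (r * b k * x))) := by
    rw [Finset.prod_mul_distrib, ← Real.exp_sum]
    congr 2
    rw [Finset.mul_sum, Finset.sum_mul]
    exact Finset.sum_congr rfl fun k _ => by ring
  simp_rw [e2]
  rw [sum_pi_prod fun k (e : ℤˣ) => 1 / 2 * Real.exp (((e : ℤ) : ℝ) * (r * b k * x))]
  calc ∏ k, ∑ e : ℤˣ, 1 / 2 * Real.exp (((e : ℤ) : ℝ) * (r * b k * x))
      ≤ ∏ k, Real.exp ((r * b k * x) ^ 2 / 2) := by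
        refine Finset.prod_le_prod (fun k _ => Finset.sum_nonneg fun e _ => by positivity)
          fun k _ => ?_
        rw [sum_units_half]
        simpa [Real.cosh_eq] using Real.cosh_le_exp_half_sq (r * b k * x)
    _ = Real.exp (lam * (∑ k, b k ^ 2) * x ^ 2) := by
        rw [← Real.exp_sum, Finset.mul_sum, Finset.sum_mul]
        congr 1
        refine Finset.sum_congr rfl fun k _ => ?_
        rw [mul_pow, mul_pow, hr]; ring

theorem one_div_sqrt_one_sub_le {y : ℝ} (h0 : 0 ≤ y) (h1 : y < 1) :
    1 / Real.sqrt (1 - y) ≤ 1 + y / 2 + 3 / 8 * y ^ 2 / (1 - y) := by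
  have hy : 0 < 1 - y := by linarith
  have hs := Real.sqrt_pos.2 hy
  have h2 : Real.sqrt (1 - y) ≤ 1 - y / 2 - y ^ 2 / 8 := by
    refine Real.sqrt_le_iff.2 ⟨by nlinarith, ?_⟩
    nlinarith [pow_nonneg h0 3, pow_nonneg h0 4]
  calc 1 / Real.sqrt (1 - y) = Real.sqrt (1 - y) / (1 - y) := by
        rw [div_eq_div_iff hs.ne' hy.ne', one_mul, Real.mul_self_sqrt hy.le]
    _ ≤ (1 - y / 2 - y ^ 2 / 8) / (1 - y) := by gcongr
    _ = _ := by field_simp; ring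

/-- Bernstein's inequality for the average of independent squared Rademacher sums with random
coefficients. -/
theorem rademacher_sq_tail {Λ : Type*} [Fintype Λ] {ν : Λ → ℝ} (hν0 : ∀ σ, 0 ≤ ν σ)
    (hν : ∑ σ, ν σ = 1) (b : Λ → κ → ℝ) {m K η : ℝ} (hm : 0 < m) (hη : 0 < η)
    (hbound : ∀ σ, ∑ k, b σ k ^ 2 ≤ m ^ 2 * K)
    (hmean : ∑ σ, ν σ * ∑ k, b σ k ^ 2 ≤ m * K) (L : ℕ) :
    ∑ u : Fin L → Λ × (κ → ℤˣ), (∏ l, (ν (u l).1 * ∏ _k : κ, (1 / 2 : ℝ))) *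
      (if (1 + η) * L * m * K < ∑ l, (∑ k, (((u l).2 k : ℤ) : ℝ) * b (u l).1 k) ^ 2
        then 1 else 0) ≤ Real.exp (-(L * η ^ 2 / (2 * m * (3 + 2 * η)))) := by
  have hs0 : ∀ σ, 0 ≤ ∑ k, b σ k ^ 2 := fun σ => Finset.sum_nonneg fun _ _ => sq_nonneg _
  have hK : 0 ≤ K := by
    obtain ⟨σ, -⟩ : ∃ σ, ν σ ≠ 0 := by
      by_contra! h; simp [h] at hν
    exact nonneg_of_mul_nonneg_right ((hs0 σ).trans (hbound σ)) (by positivity)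
  -- For `K = 0` all coefficients vanish and the strict inequality defines an empty event.
  rcases hK.eq_or_lt with rfl | hK
  · have hb : ∀ σ k, b σ k = 0 := by
      intro σ k
      have h1 := hbound σ
      rw [mul_zero] at h1
      have h2 := (Finset.sum_eq_zero_iff_of_nonneg fun k _ => sq_nonneg (b σ k)).1
        (le_antisymm h1 (hs0 σ)) k (Finset.mem_univ _)
      exact pow_eq_zero_iff two_ne_zero |>.1 h2
    simp [hb, Real.exp_nonneg]
  -- The Chernoff parameter is `lam / K`. This choice gives `1 - 2 lam m² = 3 / (3 + 2η)`, which
  -- keeps the second-order remainder below `s η / 2`. The exponent gained per column is `lam m ((1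
  -- + η) - (1 + η/2)) = η² / (2m(3 + 2η))`.
  set lam : ℝ := η / (m ^ 2 * (3 + 2 * η)) with hlam
  have hlam0 : 0 ≤ lam := by positivity
  have hlm : 1 - 2 * (lam * m ^ 2) = 3 / (3 + 2 * η) := by rw [hlam]; field_simp; ring
  have hsK : ∀ σ, lam / K * ∑ k, b σ k ^ 2 ≤ lam * m ^ 2 := by
    intro σ
    calc lam / K * ∑ k, b σ k ^ 2 ≤ lam / K * (m ^ 2 * K) := by gcongr; exact hbound σ
      _ = _ := by field_simp
  have h3 : 0 < 3 / (3 + 2 * η) := by positivity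
  have hone : ∀ σ, ∑ ψ : κ → ℤˣ, (∏ _k : κ, (1 / 2 : ℝ)) *
      Real.exp (lam / K * (∑ k, ((ψ k : ℤ) : ℝ) * b σ k) ^ 2) ≤
        1 + lam * (1 + η / 2) / K * ∑ k, b σ k ^ 2 := by
    intro σ
    have hs := hsK σ
    set s := lam / K * ∑ k, b σ k ^ 2 with hsdef
    have hspos : 0 ≤ s := mul_nonneg (by positivity) (hs0 σ)
    have h4 : 3 / (3 + 2 * η) ≤ 1 - 2 * s := by rw [← hlm]; linarith
    refine (rademacher_exp_sq_le (b σ) (by positivity) (by rw [← hsdef]; linarith)).trans ?_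
    rw [← hsdef]
    refine (one_div_sqrt_one_sub_le (by positivity) (by linarith)).trans ?_
    have h5 : 3 / 8 * (2 * s) ^ 2 / (1 - 2 * s) ≤ 3 / 8 * (2 * s) ^ 2 / (3 / (3 + 2 * η)) := by
      gcongr
    have h6 : 3 / 8 * (2 * s) ^ 2 / (3 / (3 + 2 * η)) = s * ((3 + 2 * η) / 2 * s) := by
      field_simp; ring
    have h7 : (3 + 2 * η) / 2 * s ≤ η / 2 := by
      calc (3 + 2 * η) / 2 * s ≤ (3 + 2 * η) / 2 * (lam * m ^ 2) := by gcongr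
        _ = η / 2 := by rw [hlam]; field_simp
    have h8 : s * ((3 + 2 * η) / 2 * s) ≤ s * (η / 2) := by gcongr
    have h9 : lam * (1 + η / 2) / K * ∑ k, b σ k ^ 2 = s * (1 + η / 2) := by rw [hsdef]; ring
    rw [h9]; linarith
  have hmgf : ∑ v : Λ × (κ → ℤˣ), (ν v.1 * ∏ _k : κ, (1 / 2 : ℝ)) *
      Real.exp (lam / K * (∑ k, ((v.2 k : ℤ) : ℝ) * b v.1 k) ^ 2) ≤
        Real.exp (lam * (1 + η / 2) * m) := by
    rw [Fintype.sum_prod_type]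
    calc _ = ∑ σ, ν σ * ∑ ψ : κ → ℤˣ, (∏ _k : κ, (1 / 2 : ℝ)) *
          Real.exp (lam / K * (∑ k, ((ψ k : ℤ) : ℝ) * b σ k) ^ 2) := by
          refine Finset.sum_congr rfl fun σ _ => ?_
          rw [Finset.mul_sum]
          exact Finset.sum_congr rfl fun ψ _ => by ring
      _ ≤ ∑ σ, ν σ * (1 + lam * (1 + η / 2) / K * ∑ k, b σ k ^ 2) :=
          Finset.sum_le_sum fun σ _ => mul_le_mul_of_nonneg_left (hone σ) (hν0 σ)
      _ = 1 + lam * (1 + η / 2) / K * ∑ σ, ν σ * ∑ k, b σ k ^ 2 := by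
          simp_rw [mul_add, mul_one, Finset.sum_add_distrib, hν]
          rw [Finset.mul_sum]
          congr 1
          exact Finset.sum_congr rfl fun σ _ => by ring
      _ ≤ 1 + lam * (1 + η / 2) / K * (m * K) := by gcongr
      _ = lam * (1 + η / 2) * m + 1 := by field_simp; ring
      _ ≤ _ := Real.add_one_le_exp _
  calc _ ≤ ∑ u : Fin L → Λ × (κ → ℤˣ), Real.exp (-(lam * (1 + η) * L * m)) *
        ∏ l, ((ν (u l).1 * ∏ _k : κ, (1 / 2 : ℝ)) *
          Real.exp (lam / K * (∑ k, (((u l).2 k : ℤ) : ℝ) * b (u l).1 k) ^ 2)) := by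
        refine Finset.sum_le_sum fun u _ => ?_
        have hd := Finset.prod_mul_distrib (s := Finset.univ)
          (f := fun l => ν (u l).1 * ∏ _k : κ, (1 / 2 : ℝ))
          (g := fun l => Real.exp (lam / K * (∑ k, (((u l).2 k : ℤ) : ℝ) * b (u l).1 k) ^ 2))
        rw [hd, mul_left_comm]
        refine mul_le_mul_of_nonneg_left ?_ (Finset.prod_nonneg fun l _ =>
          mul_nonneg (hν0 _) (by positivity))
        rw [← Real.exp_sum, ← Real.exp_add, ← Finset.mul_sum]
        split_ifs with h
        · rw [Real.one_le_exp_iff]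
          have : lam / K * ((1 + η) * L * m * K) ≤
              lam / K * ∑ l, (∑ k, (((u l).2 k : ℤ) : ℝ) * b (u l).1 k) ^ 2 := by gcongr
          have h2 : lam / K * ((1 + η) * L * m * K) = lam * (1 + η) * L * m := by field_simp
          linarith
        · positivity
    _ = Real.exp (-(lam * (1 + η) * L * m)) * (∑ v : Λ × (κ → ℤˣ),
          (ν v.1 * ∏ _k : κ, (1 / 2 : ℝ)) *
          Real.exp (lam / K * (∑ k, ((v.2 k : ℤ) : ℝ) * b v.1 k) ^ 2)) ^ L := by
        rw [← Finset.mul_sum, sum_pi_prod fun (_ : Fin L) (v : Λ × (κ → ℤˣ)) =>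
          (ν v.1 * ∏ _k : κ, (1 / 2 : ℝ)) *
          Real.exp (lam / K * (∑ k, ((v.2 k : ℤ) : ℝ) * b v.1 k) ^ 2)]
        simp
    _ ≤ Real.exp (-(lam * (1 + η) * L * m)) * Real.exp (lam * (1 + η / 2) * m) ^ L := by
        gcongr
        exact Finset.sum_nonneg fun v _ => mul_nonneg (mul_nonneg (hν0 _) (by positivity))
          (Real.exp_nonneg _)
    _ = _ := by
        rw [← Real.exp_nat_mul, ← Real.exp_add]
        congr 1
        rw [hlam]; field_simp; ring

end Rademacher

/-! ### Unbiased rank weights and their moments. -/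

section Weights

/-- Weights of the main effects, as a function of the rank of a variable. -/
noncomputable def mainWeight (p a : ℕ) (r : Fin p) : ℝ :=
  p * (p - 1).choose a * (p - 1 - (r : ℕ)).choose a / chooseSq a p

/-- Weights of the interactions, as a function of the rank of a variable. -/
noncomputable def interWeight (p a : ℕ) (r : Fin p) : ℝ :=
  p * ((p : ℝ) - 1) * (p - 2).choose a * (p - 1 - (r : ℕ)).choose a / chooseSqSum a p

variable {p a : ℕ}

theorem sum_fin_choose_sq : ∑ r : Fin p, ((p - 1 - (r : ℕ)).choose a : ℝ) ^ 2 = chooseSq a p := by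
  rw [Fin.sum_univ_eq_sum_range (fun r => ((p - 1 - r).choose a : ℝ) ^ 2),
    Finset.sum_range_reflect (fun t => (t.choose a : ℝ) ^ 2) p, chooseSq]

theorem sum_fin_mul_choose_sq :
    ∑ r : Fin p, ((r : ℕ) : ℝ) * ((p - 1 - (r : ℕ)).choose a : ℝ) ^ 2 = chooseSqSum a p := by
  rw [Fin.sum_univ_eq_sum_range (fun r => (r : ℝ) * ((p - 1 - r).choose a : ℝ) ^ 2),
    chooseSqSum_eq, ← Finset.sum_range_reflect]
  refine Finset.sum_congr rfl fun r hr => ?_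
  have hr := Finset.mem_range.1 hr
  have : ((p - 1 - r : ℕ) : ℝ) = (p : ℝ) - 1 - r := by
    have : p - 1 - r + 1 + r = p := by omega
    have : ((p - 1 - r : ℕ) : ℝ) + 1 + r = p := by exact_mod_cast this
    linarith
  rw [this, Nat.sub_sub_self (by omega)]

theorem chooseSq_pos (ha : a + 1 ≤ p) : 0 < chooseSq a p := by
  obtain ⟨N, rfl⟩ : ∃ N, p = N + 1 := ⟨p - 1, by omega⟩
  rw [chooseSq_succ]
  have : (0 : ℝ) < N.choose a := by exact_mod_cast Nat.choose_pos (by omega)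
  have := chooseSq_nonneg a N
  positivity

theorem chooseSqSum_nonneg (a N : ℕ) : 0 ≤ chooseSqSum a N :=
  Finset.sum_nonneg fun _ _ => chooseSq_nonneg _ _

theorem chooseSqSum_pos (ha : a + 2 ≤ p) : 0 < chooseSqSum a p := by
  obtain ⟨N, rfl⟩ : ∃ N, p = N + 1 := ⟨p - 1, by omega⟩
  rw [chooseSqSum_succ]
  have := chooseSq_pos (a := a) (p := N) (by omega)
  have := chooseSqSum_nonneg a N
  positivity

theorem mainWeight_nonneg (r : Fin p) : 0 ≤ mainWeight p a r :=
  div_nonneg (by positivity) (chooseSq_nonneg _ _)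

/-- The left side is both the second moment of the weight and its value at rank 0, which is its
maximum; one bound therefore serves the variance and the supremum. -/
theorem mainWeight_mean_le (ha : a + 1 ≤ p) :
    (p : ℝ) * ((p - 1).choose a : ℝ) ^ 2 / chooseSq a p ≤
      (2 - ((a + 1 : ℕ) : ℝ) / p) * ((a + 1 : ℕ) : ℝ) := by
  have hV := chooseSq_pos ha
  have hp : (0 : ℝ) < p := by exact_mod_cast (by omega : 0 < p)
  have h1 := choose_sq_le_chooseSq a p ha
  have h2 : (p : ℝ) * (p - 1).choose a = p.choose (a + 1) * ((a : ℝ) + 1) := by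
    obtain ⟨N, rfl⟩ : ∃ N, p = N + 1 := ⟨p - 1, by omega⟩
    have := succ_mul_choose_cast a N
    push_cast; simpa using this
  rw [div_le_iff₀ hV]
  refine le_of_mul_le_mul_left ?_ hp
  push_cast
  calc (p : ℝ) * (p * ((p - 1).choose a : ℝ) ^ 2) = (p * (p - 1).choose a : ℝ) ^ 2 := by ring
    _ = ((a : ℝ) + 1) * ((a + 1) * (p.choose (a + 1) : ℝ) ^ 2) := by rw [h2]; ring
    _ ≤ (a + 1) * ((2 * p - (a + 1)) * chooseSq a p) := by gcongr
    _ = _ := by field_simp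

theorem mainWeight_le (ha : a + 1 ≤ p) (r : Fin p) :
    mainWeight p a r ≤ (2 - ((a + 1 : ℕ) : ℝ) / p) * ((a + 1 : ℕ) : ℝ) := by
  refine le_trans ?_ (mainWeight_mean_le ha)
  rw [mainWeight, sq, ← mul_assoc]
  have := chooseSq_nonneg a p
  have h : (p - 1 - (r : ℕ)).choose a ≤ (p - 1).choose a := Nat.choose_le_choose a (by omega)
  gcongr

theorem interWeight_nonneg (hp : 1 ≤ p) (r : Fin p) : 0 ≤ interWeight p a r := by
  have : (0 : ℝ) ≤ (p : ℝ) - 1 := by rw [sub_nonneg]; exact_mod_cast hp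
  exact div_nonneg (by positivity) (chooseSqSum_nonneg _ _)

/-- Here the left side is the weight at rank 1, the largest one that matters because `k₁` must rank
before `k`; for `a + 2 ≤ p` it also equals the second moment on that event. -/
theorem interWeight_mean_le (ha : a + 1 ≤ p) (hp : 2 ≤ p) :
    (p : ℝ) * ((p : ℝ) - 1) * ((p - 2).choose a : ℝ) ^ 2 / chooseSqSum a p ≤
      2 * (2 - ((a + 1 : ℕ) : ℝ) / p) ^ 2 * ((a + 1 : ℕ) : ℝ) ^ 2 := by
  rcases ha.eq_or_lt with h | h
  · rw [Nat.choose_eq_zero_of_lt (by omega)]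
    simp only [Nat.cast_zero, ne_eq, OfNat.ofNat_ne_zero, not_false_eq_true, zero_pow, mul_zero,
      zero_div]
    positivity
  · obtain ⟨N, rfl⟩ : ∃ N, p = N + 2 := ⟨p - 2, by omega⟩
    have hW := chooseSqSum_pos (a := a) (p := N + 2) (by omega)
    have h1 := choose_sq_le_chooseSqSum a (N + 1) (by omega)
    have h2 := succ_mul_choose_cast a N
    have haN : (a : ℝ) ≤ N := by exact_mod_cast (by omega : a ≤ N)
    rw [div_le_iff₀ hW]
    push_cast at h1 ⊢
    set C : ℝ := (N.choose a : ℝ)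
    set T : ℝ := ((N + 1).choose (a + 1) : ℝ)
    set W := chooseSqSum a (N + 2)
    have h3 : ((N : ℝ) + 1) ^ 4 * C ^ 2 ≤ (a + 1) ^ 2 * ((2 * (N + 1) - (a + 1)) ^ 2 * W) := by
      calc ((N : ℝ) + 1) ^ 4 * C ^ 2 = ((N : ℝ) + 1) ^ 2 * (((N : ℝ) + 1) * C) ^ 2 := by ring
        _ = (a + 1) ^ 2 * (((N : ℝ) + 1) ^ 2 * T ^ 2) := by rw [h2]; ring
        _ ≤ _ := by gcongr
    -- The binomial inequality was used at `p - 1`; this passes from `2 - q/(p-1)` to the larger `2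
    -- - q/p`.
    have h4 : (2 * ((N : ℝ) + 1) - (a + 1)) * (N + 2) ≤ (2 * (N + 2) - (a + 1)) * (N + 1) := by
      nlinarith
    have h4' : (0 : ℝ) ≤ (2 * ((N : ℝ) + 1) - (a + 1)) := by linarith
    have h5 : ((2 * ((N : ℝ) + 1) - (a + 1)) * (N + 2)) ^ 2 ≤
        ((2 * (N + 2) - (a + 1)) * (N + 1)) ^ 2 := by gcongr
    have h6 : ((N : ℝ) + 2) ^ 2 * (N + 1) ^ 2 * C ^ 2 ≤
        (a + 1) ^ 2 * (2 * (N + 2) - (a + 1)) ^ 2 * W := by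
      have hpos : (0 : ℝ) < ((N : ℝ) + 1) ^ 2 := by positivity
      refine le_of_mul_le_mul_left ?_ hpos
      calc ((N : ℝ) + 1) ^ 2 * (((N : ℝ) + 2) ^ 2 * (N + 1) ^ 2 * C ^ 2)
          = (N + 2) ^ 2 * (((N : ℝ) + 1) ^ 4 * C ^ 2) := by ring
        _ ≤ (N + 2) ^ 2 * ((a + 1) ^ 2 * ((2 * (N + 1) - (a + 1)) ^ 2 * W)) := by gcongr
        _ = ((2 * ((N : ℝ) + 1) - (a + 1)) * (N + 2)) ^ 2 * ((a + 1) ^ 2 * W) := by ring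
        _ ≤ ((2 * (N + 2) - (a + 1)) * (N + 1)) ^ 2 * ((a + 1) ^ 2 * W) := by gcongr
        _ = _ := by ring
    have hpos : (0 : ℝ) < ((N : ℝ) + 2) ^ 2 := by positivity
    refine le_of_mul_le_mul_left ?_ hpos
    -- The factor 2 in the bound comes from `p ≤ 2(p - 1)`.
    have h7 : ((N : ℝ) + 2) * (N + 2 - 1) ≤ 2 * (N + 1) ^ 2 := by
      have : (0 : ℝ) ≤ N := N.cast_nonneg
      nlinarith
    calc ((N : ℝ) + 2) ^ 2 * ((N + 2) * (N + 2 - 1) * C ^ 2)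
        ≤ ((N : ℝ) + 2) ^ 2 * (2 * (N + 1) ^ 2 * C ^ 2) := by gcongr
      _ = 2 * (((N : ℝ) + 2) ^ 2 * (N + 1) ^ 2 * C ^ 2) := by ring
      _ ≤ 2 * ((a + 1) ^ 2 * (2 * (N + 2) - (a + 1)) ^ 2 * W) := by gcongr
      _ = _ := by field_simp

theorem interWeight_le (ha : a + 1 ≤ p) (hp : 2 ≤ p) (r : Fin p) (hr : 0 < (r : ℕ)) :
    interWeight p a r ≤ 2 * (2 - ((a + 1 : ℕ) : ℝ) / p) ^ 2 * ((a + 1 : ℕ) : ℝ) ^ 2 := by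
  refine le_trans ?_ (interWeight_mean_le ha hp)
  rw [interWeight, sq, ← mul_assoc]
  have := chooseSqSum_nonneg a p
  have hp1 : (0 : ℝ) ≤ (p : ℝ) - 1 := by
    rw [sub_nonneg]; exact_mod_cast (by omega : 1 ≤ p)
  have h : (p - 1 - (r : ℕ)).choose a ≤ (p - 2).choose a := Nat.choose_le_choose a (by omega)
  gcongr

theorem perm_mean_apply (k : Fin p) (w : Fin p → ℝ) :
    ∑ σ : Equiv.Perm (Fin p), 1 / (p.factorial : ℝ) * w (σ k) = (∑ r, w r) / p := by
  have h := sum_perm_apply k w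
  have hp : (p : ℝ) ≠ 0 := by exact_mod_cast (Fin.pos k).ne'
  have hf : (p.factorial : ℝ) ≠ 0 := by exact_mod_cast p.factorial_ne_zero
  rw [← Finset.mul_sum, eq_div_iff hp]
  field_simp
  linear_combination h

theorem perm_mean_apply_lt (hp : 2 ≤ p) {k k₁ : Fin p} (hk : k₁ ≠ k) (w : Fin p → ℝ) :
    ∑ σ : Equiv.Perm (Fin p), 1 / (p.factorial : ℝ) * (w (σ k) * if σ k₁ < σ k then 1 else 0) =
      (∑ r : Fin p, (r : ℕ) * w r) / (p * ((p : ℝ) - 1)) := by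
  have h := sum_perm_apply_lt hk w
  have hp1 : (p : ℝ) - 1 ≠ 0 := by
    have : (2 : ℝ) ≤ p := by exact_mod_cast hp
    linarith
  have hp0 : (p : ℝ) ≠ 0 := by
    have : (2 : ℝ) ≤ p := by exact_mod_cast hp
    linarith
  have h2 := perm_mean_apply k fun r => (r : ℕ) * w r
  rw [eq_div_iff hp0] at h2
  rw [eq_div_iff (mul_ne_zero hp0 hp1), ← h2, ← Finset.mul_sum, ← Finset.mul_sum]
  have h3 : ∑ σ : Equiv.Perm (Fin p), ((σ k : ℕ) : ℝ) * w (σ k) =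
      ∑ σ : Equiv.Perm (Fin p), w (σ k) * (σ k : ℕ) :=
    Finset.sum_congr rfl fun σ _ => mul_comm _ _
  rw [h3, ← h]; ring

/-- At rank `r` the event has conditional probability `C(p-1-r, a) / C(p-1, a)`. The weight is
proportional to it, so the mean is a sum of squares, which the denominator `chooseSq` normalises. -/
theorem mainWeight_unbiased {k : Fin p} {A : Finset (Fin p)} (hk : k ∉ A) (hA : A.card = a) :
    ∑ σ : Equiv.Perm (Fin p), 1 / (p.factorial : ℝ) *
      (mainWeight p a (σ k) * if ∀ j ∈ A, σ k < σ j then 1 else 0) = 1 := by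
  have hap : a + 1 ≤ p := by
    have := Finset.card_le_univ (insert k A)
    rwa [Finset.card_insert_of_notMem hk, hA, Fintype.card_fin] at this
  have h := sum_perm_mul_forall_lt (D := {k}) (k := k) (by simp)
    (F := fun σ => mainWeight p a (σ k)) (by
      intro σ j hj j' hj'
      have : Equiv.swap j j' k = k := by
        refine Equiv.swap_apply_of_ne_of_ne ?_ ?_ <;> rintro rfl <;> simp_all
      simp [this]) (by simp) A (by simpa using hk)
  rw [← Finset.mul_sum, h, Finset.mul_sum, hA, Finset.card_singleton,
    perm_mean_apply k fun r => mainWeight p a r *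
      (((p - 1 - (r : ℕ)).choose a : ℝ) / ((p - 1).choose a : ℝ))]
  have hV := chooseSq_pos hap
  have hC : (0 : ℝ) < (p - 1).choose a := by exact_mod_cast Nat.choose_pos (by omega)
  have hp : (0 : ℝ) < p := by exact_mod_cast (by omega : 0 < p)
  have e : ∀ r : Fin p, mainWeight p a r *
      (((p - 1 - (r : ℕ)).choose a : ℝ) / ((p - 1).choose a : ℝ)) =
      p / chooseSq a p * ((p - 1 - (r : ℕ)).choose a : ℝ) ^ 2 := by
    intro r; rw [mainWeight]; field_simp
  simp_rw [e]
  rw [← Finset.mul_sum, sum_fin_choose_sq]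
  field_simp

theorem mainWeight_sq_mean (ha : a + 1 ≤ p) (k : Fin p) :
    ∑ σ : Equiv.Perm (Fin p), 1 / (p.factorial : ℝ) * mainWeight p a (σ k) ^ 2 ≤
      (2 - ((a + 1 : ℕ) : ℝ) / p) * ((a + 1 : ℕ) : ℝ) := by
  refine le_of_eq_of_le ?_ (mainWeight_mean_le ha)
  rw [perm_mean_apply k fun r => mainWeight p a r ^ 2]
  have hV := chooseSq_pos ha
  have hp : (0 : ℝ) < p := by exact_mod_cast (by omega : 0 < p)
  have e : ∀ r : Fin p, mainWeight p a r ^ 2 =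
      (p * (p - 1).choose a / chooseSq a p) ^ 2 * ((p - 1 - (r : ℕ)).choose a : ℝ) ^ 2 := by
    intro r; rw [mainWeight]; ring
  simp_rw [e]
  rw [← Finset.mul_sum, sum_fin_choose_sq]
  field_simp

/-- The additional event `σ k₁ < σ k` contributes a factor proportional to the rank, which is why
the normaliser is `chooseSqSum`. -/
theorem interWeight_unbiased {k k₁ : Fin p} {A : Finset (Fin p)} (hk : k ∉ A) (hk₁ : k₁ ∉ A)
    (hne : k₁ ≠ k) (hA : A.card = a) :
    ∑ σ : Equiv.Perm (Fin p), 1 / (p.factorial : ℝ) *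
      (interWeight p a (σ k) * (if σ k₁ < σ k then 1 else 0) *
        if ∀ j ∈ A, σ k < σ j then 1 else 0) = 1 := by
  have hap : a + 2 ≤ p := by
    have := Finset.card_le_univ (insert k₁ (insert k A))
    rwa [Finset.card_insert_of_notMem (by simp [hne, hk₁]), Finset.card_insert_of_notMem hk, hA,
      Fintype.card_fin] at this
  have h := sum_perm_mul_forall_lt (D := {k, k₁}) (k := k) (by simp)
    (F := fun σ => interWeight p a (σ k) * (if σ k₁ < σ k then 1 else 0)) (by
      intro σ j hj j' hj'
      have h1 : Equiv.swap j j' k = k := by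
        refine Equiv.swap_apply_of_ne_of_ne ?_ ?_ <;> rintro rfl <;> simp_all
      have h2 : Equiv.swap j j' k₁ = k₁ := by
        refine Equiv.swap_apply_of_ne_of_ne ?_ ?_ <;> rintro rfl <;> simp_all
      simp [h1, h2]) (by
      intro σ hσ d hd
      have hlt : σ k₁ < σ k := by
        by_contra hcon; simp [hcon] at hσ
      simp only [Finset.mem_insert, Finset.mem_singleton] at hd
      rcases hd with rfl | rfl
      exacts [le_rfl, hlt.le]) A (by simp [hk, hk₁])
  rw [← Finset.mul_sum, h, Finset.mul_sum, hA, Finset.card_pair hne.symm]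
  have hW := chooseSqSum_pos hap
  have hC : (0 : ℝ) < (p - 2).choose a := by exact_mod_cast Nat.choose_pos (by omega)
  have h2p : (2 : ℝ) ≤ p := by exact_mod_cast (by omega : 2 ≤ p)
  have hp : (0 : ℝ) < p := by linarith
  have hp1 : (0 : ℝ) < (p : ℝ) - 1 := by linarith
  have e0 : ∀ σ : Equiv.Perm (Fin p), 1 / (p.factorial : ℝ) *
      (interWeight p a (σ k) * (if σ k₁ < σ k then 1 else 0) *
        (((p - 1 - (σ k : ℕ)).choose a : ℝ) / ((p - 2).choose a : ℝ))) =
      1 / (p.factorial : ℝ) * ((interWeight p a (σ k) *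
        (((p - 1 - (σ k : ℕ)).choose a : ℝ) / ((p - 2).choose a : ℝ))) *
        if σ k₁ < σ k then 1 else 0) := fun σ => by ring
  rw [Finset.sum_congr rfl fun σ _ => e0 σ, perm_mean_apply_lt (by omega) hne
    fun r => interWeight p a r * (((p - 1 - (r : ℕ)).choose a : ℝ) / ((p - 2).choose a : ℝ))]
  have e : ∀ r : Fin p, ((r : ℕ) : ℝ) * (interWeight p a r *
      (((p - 1 - (r : ℕ)).choose a : ℝ) / ((p - 2).choose a : ℝ))) =
      p * ((p : ℝ) - 1) / chooseSqSum a p *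
        ((r : ℕ) * ((p - 1 - (r : ℕ)).choose a : ℝ) ^ 2) := by
    intro r; rw [interWeight]; field_simp
  simp_rw [e]
  rw [← Finset.mul_sum, sum_fin_mul_choose_sq]
  field_simp

theorem interWeight_sq_mean (ha : a + 1 ≤ p) (hp : 2 ≤ p) (k k₁ : Fin p) :
    ∑ σ : Equiv.Perm (Fin p), 1 / (p.factorial : ℝ) *
      (interWeight p a (σ k) ^ 2 * if σ k₁ < σ k then 1 else 0) ≤
      2 * (2 - ((a + 1 : ℕ) : ℝ) / p) ^ 2 * ((a + 1 : ℕ) : ℝ) ^ 2 := by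
  rcases eq_or_ne k₁ k with rfl | hne
  · simp only [lt_irrefl, if_false, mul_zero, Finset.sum_const_zero]
    positivity
  refine le_of_eq_of_le ?_ (interWeight_mean_le ha hp)
  rw [perm_mean_apply_lt hp hne fun r => interWeight p a r ^ 2]
  have h2p : (2 : ℝ) ≤ p := by exact_mod_cast hp
  have hp0 : (0 : ℝ) < p := by linarith
  have hp1 : (0 : ℝ) < (p : ℝ) - 1 := by linarith
  have e : ∀ r : Fin p, ((r : ℕ) : ℝ) * interWeight p a r ^ 2 =
      (p * ((p : ℝ) - 1) * (p - 2).choose a / chooseSqSum a p) ^ 2 *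
        ((r : ℕ) * ((p - 1 - (r : ℕ)).choose a : ℝ) ^ 2) := by
    intro r; rw [interWeight]; ring
  simp_rw [e]
  rw [← Finset.mul_sum, sum_fin_mul_choose_sq]
  rcases (chooseSqSum_nonneg a p).eq_or_lt with h | h
  · simp [← h]
  · field_simp

end Weights

/-! ### Size of the oracle coefficients. -/

section Coefficients

variable {p : ℕ}

noncomputable def mainCoef (a : ℕ) (θ : EuclideanSpace ℝ (Fin p)) (σ : Equiv.Perm (Fin p))
    (k : Fin p) : ℝ :=
  θ k * mainWeight p a (σ k)

/-- If `k` is the hash value of a row, each `k₁` ranked before `k` lies outside the support of that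
row; the indicator thus stands in for `X i k₁ = 0` without reference to the row. -/
noncomputable def interCoef (a : ℕ) (Θ : Matrix (Fin p) (Fin p) ℝ) (σ : Equiv.Perm (Fin p))
    (k : Fin p) : ℝ :=
  interWeight p a (σ k) * ∑ k₁, Θ k k₁ * if σ k₁ < σ k then 1 else 0

variable {a : ℕ}

theorem mainCoef_sq_sum_le (ha : a + 1 ≤ p) (θ : EuclideanSpace ℝ (Fin p))
    (σ : Equiv.Perm (Fin p)) :
    ∑ k, mainCoef a θ σ k ^ 2 ≤
      ((2 - ((a + 1 : ℕ) : ℝ) / p) * ((a + 1 : ℕ) : ℝ)) ^ 2 * ‖θ‖ ^ 2 := by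
  rw [EuclideanSpace.real_norm_sq_eq, Finset.mul_sum]
  refine Finset.sum_le_sum fun k _ => ?_
  rw [mainCoef, mul_pow, mul_comm]
  have h0 := mainWeight_nonneg (a := a) (σ k)
  have h1 := mainWeight_le ha (σ k)
  gcongr

theorem mainCoef_sq_mean_le (ha : a + 1 ≤ p) (θ : EuclideanSpace ℝ (Fin p)) :
    ∑ σ : Equiv.Perm (Fin p), 1 / (p.factorial : ℝ) * ∑ k, mainCoef a θ σ k ^ 2 ≤
      ((2 - ((a + 1 : ℕ) : ℝ) / p) * ((a + 1 : ℕ) : ℝ)) * ‖θ‖ ^ 2 := by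
  simp_rw [Finset.mul_sum]
  rw [Finset.sum_comm, EuclideanSpace.real_norm_sq_eq, Finset.mul_sum]
  refine Finset.sum_le_sum fun k _ => ?_
  have e : ∀ σ : Equiv.Perm (Fin p), 1 / (p.factorial : ℝ) * mainCoef a θ σ k ^ 2 =
      1 / (p.factorial : ℝ) * mainWeight p a (σ k) ^ 2 * θ k ^ 2 := by
    intro σ; rw [mainCoef]; ring
  simp_rw [e]
  rw [← Finset.sum_mul]
  exact mul_le_mul_of_nonneg_right (mainWeight_sq_mean ha k) (sq_nonneg _)

/-- Expand the square and drop one of the two order indicators. This produces the triple sum of `|Θ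
k k₁ * Θ k k₂|` in the definition of `ℓ`. -/
theorem interCoef_sq_le (Θ : Matrix (Fin p) (Fin p) ℝ) (σ : Equiv.Perm (Fin p)) (k : Fin p) :
    interCoef a Θ σ k ^ 2 ≤ ∑ k₁, ∑ k₂, |Θ k k₁ * Θ k k₂| *
      (interWeight p a (σ k) ^ 2 * if σ k₁ < σ k then 1 else 0) := by
  rw [interCoef, mul_pow, sq (∑ k₁, _), Finset.sum_mul_sum, Finset.mul_sum]
  refine Finset.sum_le_sum fun k₁ _ => ?_
  rw [Finset.mul_sum]
  refine Finset.sum_le_sum fun k₂ _ => ?_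
  have h1 := le_abs_self (Θ k k₁ * Θ k k₂)
  have h2 := abs_nonneg (Θ k k₁ * Θ k k₂)
  have h3 := sq_nonneg (interWeight p a (σ k))
  by_cases c1 : σ k₁ < σ k <;> by_cases c2 : σ k₂ < σ k <;>
    simp only [c1, c2, if_true, if_false, mul_one, mul_zero, zero_mul, le_refl]
  · rw [mul_comm]; gcongr
  · positivity

theorem interCoef_sq_sum_le (ha : a + 1 ≤ p) (hp : 2 ≤ p) (Θ : Matrix (Fin p) (Fin p) ℝ)
    (σ : Equiv.Perm (Fin p)) :
    ∑ k, interCoef a Θ σ k ^ 2 ≤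
      (2 * (2 - ((a + 1 : ℕ) : ℝ) / p) ^ 2 * ((a + 1 : ℕ) : ℝ) ^ 2) ^ 2 *
        ∑ k, ∑ k₁, ∑ k₂, |Θ k k₁ * Θ k k₂| := by
  rw [Finset.mul_sum]
  refine Finset.sum_le_sum fun k _ => (interCoef_sq_le Θ σ k).trans ?_
  rw [Finset.mul_sum]
  refine Finset.sum_le_sum fun k₁ _ => ?_
  rw [Finset.mul_sum]
  refine Finset.sum_le_sum fun k₂ _ => ?_
  rw [mul_comm]
  refine mul_le_mul_of_nonneg_right ?_ (abs_nonneg _)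
  split_ifs with h
  · rw [mul_one]
    have h0 := interWeight_nonneg (a := a) (by omega : 1 ≤ p) (σ k)
    have h1 := interWeight_le ha hp (σ k) (lt_of_le_of_lt (Nat.zero_le _) h)
    gcongr
  · rw [mul_zero]; positivity

theorem interCoef_sq_mean_le (ha : a + 1 ≤ p) (hp : 2 ≤ p) (Θ : Matrix (Fin p) (Fin p) ℝ) :
    ∑ σ : Equiv.Perm (Fin p), 1 / (p.factorial : ℝ) * ∑ k, interCoef a Θ σ k ^ 2 ≤
      (2 * (2 - ((a + 1 : ℕ) : ℝ) / p) ^ 2 * ((a + 1 : ℕ) : ℝ) ^ 2) *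
        ∑ k, ∑ k₁, ∑ k₂, |Θ k k₁ * Θ k k₂| := by
  calc _ ≤ ∑ σ : Equiv.Perm (Fin p), 1 / (p.factorial : ℝ) * ∑ k, ∑ k₁, ∑ k₂, |Θ k k₁ * Θ k k₂| *
      (interWeight p a (σ k) ^ 2 * if σ k₁ < σ k then 1 else 0) := by
        refine Finset.sum_le_sum fun σ _ => mul_le_mul_of_nonneg_left ?_ (by positivity)
        exact Finset.sum_le_sum fun k _ => interCoef_sq_le Θ σ k
    _ = ∑ k, ∑ k₁, ∑ k₂, |Θ k k₁ * Θ k k₂| * ∑ σ : Equiv.Perm (Fin p), 1 / (p.factorial : ℝ) *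
      (interWeight p a (σ k) ^ 2 * if σ k₁ < σ k then 1 else 0) := by
        simp_rw [Finset.mul_sum]
        rw [Finset.sum_comm]
        refine Finset.sum_congr rfl fun k _ => ?_
        rw [Finset.sum_comm]
        refine Finset.sum_congr rfl fun k₁ _ => ?_
        rw [Finset.sum_comm]
        refine Finset.sum_congr rfl fun k₂ _ => Finset.sum_congr rfl fun σ _ => ?_
        ring
    _ ≤ _ := by
        rw [Finset.mul_sum]
        refine Finset.sum_le_sum fun k _ => ?_
        rw [Finset.mul_sum]
        refine Finset.sum_le_sum fun k₁ _ => ?_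
        rw [Finset.mul_sum]
        refine Finset.sum_le_sum fun k₂ _ => ?_
        rw [mul_comm]
        exact mul_le_mul_of_nonneg_right (interWeight_sq_mean ha hp k k₁) (abs_nonneg _)

/-- Minkowski's inequality with a common scale `m`. -/
theorem sum_add_sq_le {ι : Type*} (I : Finset ι) (x y : ι → ℝ) {m s t : ℝ} (hm : 0 ≤ m)
    (hs : 0 ≤ s) (ht : 0 ≤ t) (hx : ∑ i ∈ I, x i ^ 2 ≤ m * s ^ 2)
    (hy : ∑ i ∈ I, y i ^ 2 ≤ m * t ^ 2) : ∑ i ∈ I, (x i + y i) ^ 2 ≤ m * (s + t) ^ 2 := by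
  have hxy : ∑ i ∈ I, x i * y i ≤ m * s * t := by
    refine le_of_sq_le_sq ?_ (by positivity)
    calc (∑ i ∈ I, x i * y i) ^ 2 ≤ (∑ i ∈ I, x i ^ 2) * ∑ i ∈ I, y i ^ 2 :=
          Finset.sum_mul_sq_le_sq_mul_sq _ _ _
      _ ≤ (m * s ^ 2) * (m * t ^ 2) := by
          gcongr
      _ = _ := by ring
  have e : ∑ i ∈ I, (x i + y i) ^ 2 =
      ∑ i ∈ I, x i ^ 2 + 2 * ∑ i ∈ I, x i * y i + ∑ i ∈ I, y i ^ 2 := by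
    rw [Finset.mul_sum, ← Finset.sum_add_distrib, ← Finset.sum_add_distrib]
    exact Finset.sum_congr rfl fun i _ => by ring
  rw [e]
  nlinarith

theorem coef_sq_mean_le (ha : a + 1 ≤ p) (hp : 2 ≤ p) (θ : EuclideanSpace ℝ (Fin p))
    (Θ : Matrix (Fin p) (Fin p) ℝ) :
    ∑ σ : Equiv.Perm (Fin p), 1 / (p.factorial : ℝ) *
      ∑ k, (mainCoef a θ σ k + interCoef a Θ σ k) ^ 2 ≤
      ((2 - ((a + 1 : ℕ) : ℝ) / p) * ((a + 1 : ℕ) : ℝ)) * interactionNorm (a + 1) θ Θ ^ 2 := by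
  have h1 := mainCoef_sq_mean_le ha θ
  have h2 := interCoef_sq_mean_le ha hp Θ
  have hf : (0 : ℝ) < p.factorial := by exact_mod_cast p.factorial_pos
  have hp0 : (0 : ℝ) < p := by exact_mod_cast (by omega : 0 < p)
  have hδ : ((a + 1 : ℕ) : ℝ) / p ≤ 1 := (div_le_one hp0).2 (by exact_mod_cast ha)
  rw [interactionNorm]
  set q : ℝ := ((a + 1 : ℕ) : ℝ)
  set Q : ℝ := ∑ k, ∑ k₁, ∑ k₂, |Θ k k₁ * Θ k k₂|
  have hq0 : 0 ≤ q := Nat.cast_nonneg _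
  have hQ : 0 ≤ Q := Finset.sum_nonneg fun _ _ => Finset.sum_nonneg fun _ _ =>
    Finset.sum_nonneg fun _ _ => abs_nonneg _
  have h2δ : 0 ≤ 2 - q / p := by linarith
  set t := Real.sqrt (2 * (2 - q / p) * q * Q)
  have ht : t ^ 2 = 2 * (2 - q / p) * q * Q := Real.sq_sqrt (by positivity)
  -- Minkowski is applied jointly in the permutation and the index; the factor `p!` clears the
  -- uniform weight. The interaction bound fits because `2(2-δ)²q² Q = (2-δ)q t²`.
  have key := sum_add_sq_le (Finset.univ : Finset (Equiv.Perm (Fin p) × Fin p))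
    (fun x => mainCoef a θ x.1 x.2) (fun x => interCoef a Θ x.1 x.2)
    (m := p.factorial * ((2 - q / p) * q)) (s := ‖θ‖) (t := t) (by positivity) (norm_nonneg _)
    (Real.sqrt_nonneg _) (by
      rw [Fintype.sum_prod_type]
      rw [← Finset.mul_sum, div_mul_eq_mul_div, one_mul, div_le_iff₀ hf] at h1
      linarith) (by
      rw [Fintype.sum_prod_type, ht]
      rw [← Finset.mul_sum, div_mul_eq_mul_div, one_mul, div_le_iff₀ hf] at h2
      calc _ ≤ _ := h2
        _ = _ := by ring)
  rw [Fintype.sum_prod_type] at key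
  rw [← Finset.mul_sum, div_mul_eq_mul_div, one_mul, div_le_iff₀ hf]
  calc _ ≤ _ := key
    _ = _ := by ring

end Coefficients

/-! ### The oracle vector: unbiasedness, mean squared error and norm. -/

section Oracle

variable {n p L a : ℕ} {X : Matrix (Fin n) (Fin p) ℝ}

/-- The compressed matrix built from pairs of a permutation and signs. -/
noncomputable def hashMatrix (X : Matrix (Fin n) (Fin p) ℝ)
    (u : Fin L → Equiv.Perm (Fin p) × (Fin p → ℤˣ)) : Matrix (Fin n) (Fin L) ℝ :=
  signHash X (fun l => (u l).1) fun k l => (u l).2 k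

/-- An entry of the compressed matrix. -/
noncomputable def hashEntry (X : Matrix (Fin n) (Fin p) ℝ) (i : Fin n)
    (v : Equiv.Perm (Fin p) × (Fin p → ℤˣ)) : ℝ :=
  hashMatrix X (fun _ : Fin 1 => v) i 0

theorem hashMatrix_apply (u : Fin L → Equiv.Perm (Fin p) × (Fin p → ℤˣ)) (i : Fin n) (l : Fin L) :
    hashMatrix X u i l = hashEntry X i (u l) := rfl

theorem hashEntry_of_nonempty {i : Fin n} (h : (rowSupport X i).Nonempty)
    (v : Equiv.Perm (Fin p) × (Fin p → ℤˣ)) :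
    hashEntry X i v = ((v.2 (hashIndex X v.1 i h) : ℤ) : ℝ) * X i (hashIndex X v.1 i h) := by
  simp [hashEntry, hashMatrix, signHash, h]

theorem units_cast_sq (e : ℤˣ) : ((e : ℤ) : ℝ) ^ 2 = 1 := by
  rcases Int.units_eq_one_or e with rfl | rfl <;> simp

theorem hashEntry_sq_le (hX : ∀ i k, |X i k| ≤ 1) {i : Fin n} (h : (rowSupport X i).Nonempty)
    (v : Equiv.Perm (Fin p) × (Fin p → ℤˣ)) : hashEntry X i v ^ 2 ≤ 1 := by
  rw [hashEntry_of_nonempty h, mul_pow, units_cast_sq, one_mul, sq_le_one_iff_abs_le_one]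
  exact hX _ _

theorem hashIndex_eq_iff {i : Fin n} (h : (rowSupport X i).Nonempty) (σ : Equiv.Perm (Fin p))
    (k : Fin p) : hashIndex X σ i h = k ↔
      k ∈ rowSupport X i ∧ ∀ j ∈ (rowSupport X i).erase k, σ k < σ j := by
  rw [hashIndex, Equiv.symm_apply_eq]
  constructor
  · intro hk
    have hmem := Finset.min'_mem _ (h.image σ)
    rw [hk] at hmem
    refine ⟨by simpa using hmem, fun j hj => ?_⟩
    rw [Finset.mem_erase] at hj
    rw [← hk]
    refine lt_of_le_of_ne (Finset.min'_le _ _ (Finset.mem_image_of_mem σ hj.2)) fun he => hj.1 ?_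
    rw [hk] at he
    exact (σ.injective he).symm
  · rintro ⟨hk, hlt⟩
    refine le_antisymm (Finset.min'_le _ _ (Finset.mem_image_of_mem σ hk))
      (Finset.le_min' _ _ _ fun r hr => ?_)
    obtain ⟨j, hj, rfl⟩ := Finset.mem_image.1 hr
    rcases eq_or_ne j k with rfl | hjk
    · exact le_rfl
    · exact (hlt j (Finset.mem_erase.2 ⟨hjk, hj⟩)).le

/-- The mean is `X i H * b H` at the hash value `H`. Writing it as a sum over the support exposes
the order event that the rank weights are built for. -/
theorem hashEntry_sign_mean {i : Fin n} (h : (rowSupport X i).Nonempty) (σ : Equiv.Perm (Fin p))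
    (b : Fin p → ℝ) :
    ∑ ψ : Fin p → ℤˣ, (∏ _k : Fin p, (1 / 2 : ℝ)) *
      (hashEntry X i (σ, ψ) * ∑ k, ((ψ k : ℤ) : ℝ) * b k) =
      ∑ k ∈ rowSupport X i, X i k *
        (b k * if ∀ j ∈ (rowSupport X i).erase k, σ k < σ j then 1 else 0) := by
  set H := hashIndex X σ i h with hH
  have hHk := (hashIndex_eq_iff h σ H).1 hH.symm
  have e : ∀ ψ : Fin p → ℤˣ, (∏ _k : Fin p, (1 / 2 : ℝ)) *
      (hashEntry X i (σ, ψ) * ∑ k, ((ψ k : ℤ) : ℝ) * b k) =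
      X i H * ((∏ _k : Fin p, (1 / 2 : ℝ)) *
        (((ψ H : ℤ) : ℝ) * ∑ k, ((ψ k : ℤ) : ℝ) * b k)) := by
    intro ψ; rw [hashEntry_of_nonempty h, ← hH]; ring
  rw [Finset.sum_congr rfl fun ψ _ => e ψ, ← Finset.mul_sum, rademacher_mul_sum,
    Finset.sum_eq_single_of_mem H hHk.1, if_pos hHk.2, mul_one]
  intro k hk hne
  rw [if_neg, mul_zero, mul_zero]
  exact fun hlt => hne ((hashIndex_eq_iff h σ k).2 ⟨hk, hlt⟩ ▸ hH.symm ▸ rfl)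

theorem interactionSignal_eq (θ : EuclideanSpace ℝ (Fin p)) (Θ : Matrix (Fin p) (Fin p) ℝ)
    (i : Fin n) : interactionSignal X θ Θ i = ∑ k ∈ rowSupport X i, X i k *
      (θ k + ∑ k₁, Θ k k₁ * if X i k₁ = 0 then 1 else 0) := by
  rw [rowSupport, Finset.sum_filter, interactionSignal, ← Finset.sum_add_distrib]
  refine Finset.sum_congr rfl fun k _ => ?_
  split_ifs with hk
  · rw [mul_add, Finset.mul_sum]
    congr 1
    exact Finset.sum_congr rfl fun k₁ _ => by ring
  · simp [not_not.1 hk]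

theorem hashEntry_mean {i : Fin n} (h : (rowSupport X i).card = a + 1)
    (θ : EuclideanSpace ℝ (Fin p)) (Θ : Matrix (Fin p) (Fin p) ℝ) :
    ∑ v : Equiv.Perm (Fin p) × (Fin p → ℤˣ), 1 / (p.factorial : ℝ) * (∏ _k : Fin p, (1 / 2 : ℝ)) *
      (hashEntry X i v *
        ∑ k, ((v.2 k : ℤ) : ℝ) * (mainCoef a θ v.1 k + interCoef a Θ v.1 k)) =
      interactionSignal X θ Θ i := by
  have hne : (rowSupport X i).Nonempty := Finset.card_pos.1 (by omega)
  rw [Fintype.sum_prod_type]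
  have e : ∀ σ : Equiv.Perm (Fin p), ∑ ψ : Fin p → ℤˣ,
      1 / (p.factorial : ℝ) * (∏ _k : Fin p, (1 / 2 : ℝ)) * (hashEntry X i (σ, ψ) *
        ∑ k, ((ψ k : ℤ) : ℝ) * (mainCoef a θ σ k + interCoef a Θ σ k)) =
      ∑ k ∈ rowSupport X i, X i k * (1 / (p.factorial : ℝ) *
        ((mainCoef a θ σ k + interCoef a Θ σ k) *
          if ∀ j ∈ (rowSupport X i).erase k, σ k < σ j then 1 else 0)) := by
    intro σ
    simp_rw [mul_assoc]
    rw [← Finset.mul_sum, hashEntry_sign_mean hne, Finset.mul_sum]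
    exact Finset.sum_congr rfl fun k _ => by ring
  rw [Finset.sum_congr rfl fun σ _ => e σ, Finset.sum_comm, interactionSignal_eq]
  refine Finset.sum_congr rfl fun k hk => ?_
  rw [← Finset.mul_sum]
  congr 1
  have hcard : ((rowSupport X i).erase k).card = a := by
    rw [Finset.card_erase_of_mem hk, h]; rfl
  simp_rw [add_mul, mul_add, Finset.sum_add_distrib]
  congr 1
  · have e2 : ∀ σ : Equiv.Perm (Fin p), 1 / (p.factorial : ℝ) * (mainCoef a θ σ k *
        if ∀ j ∈ (rowSupport X i).erase k, σ k < σ j then 1 else 0) =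
        θ k * (1 / (p.factorial : ℝ) * (mainWeight p a (σ k) *
          if ∀ j ∈ (rowSupport X i).erase k, σ k < σ j then 1 else 0)) := by
      intro σ; rw [mainCoef]; ring
    rw [Finset.sum_congr rfl fun σ _ => e2 σ, ← Finset.mul_sum,
      mainWeight_unbiased (by simp) hcard, mul_one]
  · have e2 : ∀ σ : Equiv.Perm (Fin p), 1 / (p.factorial : ℝ) * (interCoef a Θ σ k *
        if ∀ j ∈ (rowSupport X i).erase k, σ k < σ j then 1 else 0) =
        ∑ k₁, Θ k k₁ * (1 / (p.factorial : ℝ) *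
          (interWeight p a (σ k) * (if σ k₁ < σ k then 1 else 0) *
          if ∀ j ∈ (rowSupport X i).erase k, σ k < σ j then 1 else 0)) := by
      intro σ
      rw [interCoef, Finset.mul_sum, Finset.sum_mul, Finset.mul_sum]
      exact Finset.sum_congr rfl fun k₁ _ => by ring
    rw [Finset.sum_congr rfl fun σ _ => e2 σ, Finset.sum_comm]
    refine Finset.sum_congr rfl fun k₁ _ => ?_
    rw [← Finset.mul_sum]
    congr 1
    have hk0 : X i k ≠ 0 := by simpa [rowSupport] using hk
    by_cases hk₁ : X i k₁ = 0
    · rw [if_pos hk₁]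
      exact interWeight_unbiased (by simp) (by simp [rowSupport, hk₁])
        (by rintro rfl; exact hk0 hk₁) hcard
    -- A `k₁` in the support cannot rank before the hash value `k`, so every summand vanishes,
    -- including the one with `k₁ = k`.
    · rw [if_neg hk₁]
      refine Finset.sum_eq_zero fun σ _ => ?_
      rcases eq_or_ne k₁ k with rfl | hne'
      · simp
      · by_cases hlt : ∀ j ∈ (rowSupport X i).erase k, σ k < σ j
        · have := hlt k₁ (by simp [rowSupport, hne', hk₁])
          simp [not_lt.2 this.le]
        · rw [if_neg hlt, mul_zero, mul_zero]

/-- The coefficient vector on the compressed matrix that belongs to the coefficients `b`. -/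
noncomputable def oracle (b : Equiv.Perm (Fin p) → Fin p → ℝ)
    (u : Fin L → Equiv.Perm (Fin p) × (Fin p → ℤˣ)) : EuclideanSpace ℝ (Fin L) :=
  WithLp.toLp 2 fun l => 1 / (L : ℝ) * ∑ k, (((u l).2 k : ℤ) : ℝ) * b (u l).1 k

theorem oracle_add (b b' : Equiv.Perm (Fin p) → Fin p → ℝ)
    (u : Fin L → Equiv.Perm (Fin p) × (Fin p → ℤˣ)) :
    oracle (fun σ k => b σ k + b' σ k) u = oracle b u + oracle b' u := by
  ext l
  simp [oracle, mul_add, Finset.sum_add_distrib]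

theorem oracle_norm_sq (b : Equiv.Perm (Fin p) → Fin p → ℝ)
    (u : Fin L → Equiv.Perm (Fin p) × (Fin p → ℤˣ)) :
    ‖oracle b u‖ ^ 2 =
      (∑ l, (∑ k, (((u l).2 k : ℤ) : ℝ) * b (u l).1 k) ^ 2) / (L : ℝ) ^ 2 := by
  rw [EuclideanSpace.real_norm_sq_eq, Finset.sum_div]
  exact Finset.sum_congr rfl fun l _ => by simp only [oracle]; ring

theorem perm_weight_sum : ∑ _σ : Equiv.Perm (Fin p), 1 / (p.factorial : ℝ) = 1 := by
  have : (p.factorial : ℝ) ≠ 0 := by exact_mod_cast p.factorial_ne_zero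
  simp [Fintype.card_perm, this]

theorem hash_weight_sum : ∑ _v : Equiv.Perm (Fin p) × (Fin p → ℤˣ),
    1 / (p.factorial : ℝ) * ∏ _k : Fin p, (1 / 2 : ℝ) = 1 := by
  rw [Fintype.sum_prod_type]
  have h : ∑ _ψ : Fin p → ℤˣ, ∏ _k : Fin p, (1 / 2 : ℝ) = 1 :=
    pi_weight_sum (ι := Fin p) (α := ℤˣ) (μ := fun _ _ => (1 / 2 : ℝ)) fun _ => by simp
  rw [Finset.sum_congr rfl fun σ _ => by rw [← Finset.mul_sum, h, mul_one]]
  exact perm_weight_sum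

/-- The error is an average of `L` independent centred variables. Each has variance at most the mean
of `∑ k, b σ k ^ 2`, since hash entries have square at most 1 and the signs are orthogonal. -/
theorem oracle_mean_sq_error (hL : 1 ≤ L) (hap : a + 1 ≤ p) (hp : 2 ≤ p)
    (hX : ∀ i k, |X i k| ≤ 1) {i : Fin n}
    (h : (rowSupport X i).card = a + 1)
    (θ : EuclideanSpace ℝ (Fin p)) (Θ : Matrix (Fin p) (Fin p) ℝ) :
    ∑ u : Fin L → Equiv.Perm (Fin p) × (Fin p → ℤˣ),
      (∏ _l : Fin L, (1 / (p.factorial : ℝ) * ∏ _k : Fin p, (1 / 2 : ℝ))) *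
      ((hashMatrix X u).mulVec (oracle (fun σ k => mainCoef a θ σ k + interCoef a Θ σ k) u).ofLp i -
        interactionSignal X θ Θ i) ^ 2 ≤
      ((2 - ((a + 1 : ℕ) : ℝ) / p) * ((a + 1 : ℕ) : ℝ)) * interactionNorm (a + 1) θ Θ ^ 2 / L := by
  have hne : (rowSupport X i).Nonempty := Finset.card_pos.1 (by omega)
  have hL0 : (0 : ℝ) < L := by exact_mod_cast hL
  have hmean := hashEntry_mean h θ Θ
  have hcoef := coef_sq_mean_le hap hp θ Θ
  set f := interactionSignal X θ Θ i
  set B := ((2 - ((a + 1 : ℕ) : ℝ) / p) * ((a + 1 : ℕ) : ℝ)) * interactionNorm (a + 1) θ Θ ^ 2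
  set b : Equiv.Perm (Fin p) → Fin p → ℝ := fun σ k => mainCoef a θ σ k + interCoef a Θ σ k
  set c : ℝ := 1 / (p.factorial : ℝ) * ∏ _k : Fin p, (1 / 2 : ℝ) with hc
  set g : Equiv.Perm (Fin p) × (Fin p → ℤˣ) → ℝ :=
    fun v => hashEntry X i v * ∑ k, ((v.2 k : ℤ) : ℝ) * b v.1 k with hg
  have hcsum : ∑ _v : Equiv.Perm (Fin p) × (Fin p → ℤˣ), c = 1 := hash_weight_sum
  have hc0 : 0 ≤ c := by positivity
  have hmean' : ∑ v, c * g v = f := hmean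
  have hconst : ∀ z : ℝ, ∑ _v : Equiv.Perm (Fin p) × (Fin p → ℤˣ), z * c = z := fun z => by
    rw [← Finset.mul_sum, hcsum, mul_one]
  have hlin : ∀ z : ℝ, ∑ v, z * (c * g v) = z * f := fun z => by rw [← Finset.mul_sum, hmean']
  have hsq : ∑ v, c * g v ^ 2 ≤ B := by
    refine le_trans ?_ hcoef
    rw [Fintype.sum_prod_type]
    refine Finset.sum_le_sum fun σ _ => ?_
    rw [← rademacher_sum_sq (b σ), Finset.mul_sum]
    refine Finset.sum_le_sum fun ψ _ => ?_
    rw [← mul_assoc]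
    refine mul_le_mul_of_nonneg_left ?_ hc0
    rw [hg, mul_pow]
    exact mul_le_of_le_one_left (sq_nonneg _) (hashEntry_sq_le hX hne _)
  have e : ∀ u : Fin L → Equiv.Perm (Fin p) × (Fin p → ℤˣ),
      (hashMatrix X u).mulVec (oracle b u).ofLp i - f = ∑ l, 1 / (L : ℝ) * (g (u l) - f) := by
    intro u
    rw [← Finset.mul_sum, Finset.sum_sub_distrib, mul_sub]
    simp only [Finset.sum_const, Finset.card_univ, Fintype.card_fin, nsmul_eq_mul]
    rw [← mul_assoc, one_div_mul_cancel hL0.ne', one_mul, Matrix.mulVec, dotProduct,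
      Finset.mul_sum]
    congr 1
    refine Finset.sum_congr rfl fun l _ => ?_
    rw [hashMatrix_apply, hg, oracle]
    ring
  simp_rw [e]
  rw [pi_expect_sum_sq (ι := Fin L) (μ := fun _ _ => c) (g := fun _ v => 1 / (L : ℝ) * (g v - f))
    (fun _ => hcsum) fun _ => ?_]
  · have e2 : ∑ v, c * (1 / (L : ℝ) * (g v - f)) ^ 2 =
        (∑ v, c * g v ^ 2 - f ^ 2) / (L : ℝ) ^ 2 := by
      have : ∀ v, c * (1 / (L : ℝ) * (g v - f)) ^ 2 =
          (c * g v ^ 2 - 2 * f * (c * g v) + f ^ 2 * c) / (L : ℝ) ^ 2 := by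
        intro v; ring
      simp_rw [this]
      rw [← Finset.sum_div, Finset.sum_add_distrib, Finset.sum_sub_distrib, hlin, hconst]
      ring
    rw [e2, Finset.sum_const, Finset.card_univ, Fintype.card_fin, nsmul_eq_mul]
    calc (L : ℝ) * ((∑ v, c * g v ^ 2 - f ^ 2) / (L : ℝ) ^ 2)
        = (∑ v, c * g v ^ 2 - f ^ 2) / L := by field_simp
      _ ≤ B / L := by gcongr; linarith [sq_nonneg f]
  · have : ∀ v, c * (1 / (L : ℝ) * (g v - f)) = 1 / (L : ℝ) * (c * g v - f * c) := by
      intro v; ring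
    simp_rw [this]
    rw [← Finset.mul_sum, Finset.sum_sub_distrib, hmean', hconst, sub_self, mul_zero]

theorem oracle_tail (b : Equiv.Perm (Fin p) → Fin p → ℝ) {m K η : ℝ} (hL : 1 ≤ L) (hm : 0 < m)
    (hη : 0 < η) (hbound : ∀ σ, ∑ k, b σ k ^ 2 ≤ m ^ 2 * K)
    (hmean : ∑ σ : Equiv.Perm (Fin p), 1 / (p.factorial : ℝ) * ∑ k, b σ k ^ 2 ≤ m * K) :
    ∑ u : Fin L → Equiv.Perm (Fin p) × (Fin p → ℤˣ),
      (∏ _l : Fin L, (1 / (p.factorial : ℝ) * ∏ _k : Fin p, (1 / 2 : ℝ))) *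
      (if (1 + η) * (m * K / L) < ‖oracle b u‖ ^ 2 then 1 else 0) ≤
      Real.exp (-(L * η ^ 2 / (2 * m * (3 + 2 * η)))) := by
  have hL0 : (0 : ℝ) < L := by exact_mod_cast hL
  refine le_of_eq_of_le (Finset.sum_congr rfl fun u _ => ?_)
    (rademacher_sq_tail (ν := fun _ => 1 / (p.factorial : ℝ)) (fun _ => by positivity)
      perm_weight_sum b hm hη hbound hmean L)
  congr 2
  rw [oracle_norm_sq, lt_div_iff₀ (by positivity), eq_iff_iff]
  have : (1 + η) * (m * K / L) * (L : ℝ) ^ 2 = (1 + η) * L * m * K := by field_simp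
  rw [this]

/-- A union bound over the main-effect and interaction parts; each part contributes one exponential
of `rho2`. -/
theorem oracle_norm_tail (hL : 1 ≤ L) (hap : a + 1 ≤ p) (hp : 2 ≤ p) {η : ℝ} (hη : 0 < η)
    (θ : EuclideanSpace ℝ (Fin p)) (Θ : Matrix (Fin p) (Fin p) ℝ) :
    ∑ u : Fin L → Equiv.Perm (Fin p) × (Fin p → ℤˣ),
      (∏ _l : Fin L, (1 / (p.factorial : ℝ) * ∏ _k : Fin p, (1 / 2 : ℝ))) *
      (if (1 + η) * ((2 - ((a + 1 : ℕ) : ℝ) / p) * ((a + 1 : ℕ) : ℝ) *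
        interactionNorm (a + 1) θ Θ ^ 2 / L) <
        ‖oracle (fun σ k => mainCoef a θ σ k + interCoef a Θ σ k) u‖ ^ 2 then 1 else 0) ≤
      rho2 p (a + 1) L η := by
  have h1 := mainCoef_sq_sum_le hap θ
  have h2 := mainCoef_sq_mean_le hap θ
  have h3 := interCoef_sq_sum_le hap hp Θ
  have h4 := interCoef_sq_mean_le hap hp Θ
  have hp0 : (0 : ℝ) < p := by exact_mod_cast (by omega : 0 < p)
  have hδ : ((a + 1 : ℕ) : ℝ) / p ≤ 1 := (div_le_one hp0).2 (by exact_mod_cast hap)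
  have hq0 : (0 : ℝ) < ((a + 1 : ℕ) : ℝ) := by positivity
  have hL0 : (0 : ℝ) < L := by exact_mod_cast hL
  rw [interactionNorm, rho2]
  set q : ℝ := ((a + 1 : ℕ) : ℝ)
  set Q : ℝ := ∑ k, ∑ k₁, ∑ k₂, |Θ k k₁ * Θ k k₂|
  have hQ : 0 ≤ Q := Finset.sum_nonneg fun _ _ => Finset.sum_nonneg fun _ _ =>
    Finset.sum_nonneg fun _ _ => abs_nonneg _
  have h2δ : 0 < 2 - q / p := by linarith
  have t1 := oracle_tail (L := L) (mainCoef a θ) hL (by positivity) hη h1 h2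
  have t2 := oracle_tail (L := L) (interCoef a Θ) hL (by positivity) hη h3 h4
  have e1 : 2 * ((2 - q / p) * q) * (3 + 2 * η) = 2 * (2 - q / p) * (3 + 2 * η) * q := by ring
  have e2 : 2 * (2 * (2 - q / p) ^ 2 * q ^ 2) * (3 + 2 * η) =
      4 * (2 - q / p) ^ 2 * (3 + 2 * η) * q ^ 2 := by ring
  rw [e1] at t1
  rw [e2] at t2
  refine le_trans ?_ (add_le_add t1 t2)
  rw [← Finset.sum_add_distrib]
  refine Finset.sum_le_sum fun u _ => ?_
  rw [← mul_add]
  refine mul_le_mul_of_nonneg_left ?_ (by positivity)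
  split_ifs with c0 c1 c2 c2 c1 c2 c2 <;> norm_num
  refine absurd c0 (not_lt.2 ?_)
  rw [not_lt] at c1 c2
  set t := Real.sqrt (2 * (2 - q / p) * q * Q)
  have ht : t ^ 2 = 2 * (2 - q / p) * q * Q := Real.sq_sqrt (by positivity)
  -- With this common scale the two norm thresholds are `r ‖θ‖` and `r t`, so the triangle
  -- inequality lands exactly on the threshold for `ℓ = ‖θ‖ + t`.
  set r := Real.sqrt ((1 + η) * ((2 - q / p) * q / L))
  have hr : r ^ 2 = (1 + η) * ((2 - q / p) * q / L) := Real.sq_sqrt (by positivity)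
  have ht0 : 0 ≤ t := Real.sqrt_nonneg _
  have hr0 : 0 ≤ r := Real.sqrt_nonneg _
  have n1 : ‖oracle (mainCoef a θ) u‖ ≤ r * ‖θ‖ := by
    refine le_of_sq_le_sq (c1.trans_eq ?_) (by positivity)
    rw [mul_pow, hr]; ring
  have n2 : ‖oracle (interCoef a Θ) u‖ ≤ r * t := by
    refine le_of_sq_le_sq (c2.trans_eq ?_) (by positivity)
    rw [mul_pow, hr, ht]; ring
  have n3 := (norm_add_le (oracle (mainCoef a θ) u) (oracle (interCoef a Θ) u)).trans
    (add_le_add n1 n2)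
  rw [oracle_add]
  calc ‖oracle (mainCoef a θ) u + oracle (interCoef a Θ) u‖ ^ 2 ≤ (r * ‖θ‖ + r * t) ^ 2 := by
        gcongr
    _ = r ^ 2 * (‖θ‖ + t) ^ 2 := by ring
    _ = _ := by rw [hr]; ring

end Oracle

/-! ### Logistic loss: quadratic upper bound, basic inequality and score. -/

section Logistic

open ProbabilityTheory

/-- Hoeffding's lemma for a Bernoulli variable. -/
theorem log_bernoulli_mgf_le {c : ℝ} (h0 : 0 < c) (h1 : c < 1) (s : ℝ) :
    Real.log (1 - c + c * Real.exp s) - c * s ≤ s ^ 2 / 8 := by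
  set μ : Measure ℝ := ENNReal.ofReal c • Measure.dirac 1 + ENNReal.ofReal (1 - c) •
    Measure.dirac 0 with hμ
  have hprob : IsProbabilityMeasure μ := ⟨by
    rw [hμ]
    simp only [Measure.coe_add, Measure.coe_smul, Pi.add_apply, Pi.smul_apply, measure_univ,
      smul_eq_mul, mul_one]
    rw [← ENNReal.ofReal_add h0.le (by linarith)]
    simp⟩
  have hint : ∀ f : ℝ → ℝ, ∫ x, f x ∂μ = c * f 1 + (1 - c) * f 0 := by
    intro f
    have hd : ∀ x : ℝ, Integrable f (Measure.dirac x) := fun x =>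
      integrable_dirac (by simp)
    rw [hμ, integral_add_measure ((hd 1).smul_measure (by simp))
      ((hd 0).smul_measure (by simp)), integral_smul_measure, integral_smul_measure,
      integral_dirac, integral_dirac, ENNReal.toReal_ofReal h0.le,
      ENNReal.toReal_ofReal (by linarith), smul_eq_mul, smul_eq_mul]
  have hmem : ∀ᵐ x ∂μ, id x ∈ Set.Icc (0 : ℝ) 1 := by
    rw [hμ, ae_add_measure_iff]
    constructor
    · refine Measure.ae_smul_measure ?_ _
      rw [ae_dirac_eq]; simp
    · refine Measure.ae_smul_measure ?_ _
      rw [ae_dirac_eq]; simp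
  have h := (hasSubgaussianMGF_of_mem_Icc (X := id) aemeasurable_id hmem).mgf_le s
  have hmean : ∫ x, id x ∂μ = c := by rw [hint]; simp
  rw [mgf, hmean, hint] at h
  have hpos : 0 < 1 - c + c * Real.exp s := by
    have := Real.exp_pos s
    nlinarith
  have e : 1 - c + c * Real.exp s =
      Real.exp (c * s) * (c * Real.exp (s * (id 1 - c)) + (1 - c) * Real.exp (s * (id 0 - c))) := by
    simp only [id]
    rw [mul_add, mul_left_comm, mul_left_comm (Real.exp (c * s)), ← Real.exp_add, ← Real.exp_add,
      show c * s + s * (1 - c) = s by ring, show c * s + s * (0 - c) = 0 by ring, Real.exp_zero]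
    ring
  have h2 : 1 - c + c * Real.exp s ≤ Real.exp (c * s + s ^ 2 / 8) := by
    rw [e, Real.exp_add]
    refine mul_le_mul_of_nonneg_left (h.trans_eq ?_) (Real.exp_nonneg _)
    congr 1
    simp
    ring
  have := Real.log_le_log hpos h2
  rw [Real.log_exp] at this
  linarith

/-- The excess loss is exactly the logarithm of the moment generating function of a centred
Bernoulli variable, evaluated at `t - g`. -/
theorem logistic_sub_le {c g : ℝ} (h0 : 0 < c) (h1 : c < 1) (hg : Real.log (c / (1 - c)) = g)
    (t : ℝ) : (-c * t + Real.log (1 + Real.exp t)) - (-c * g + Real.log (1 + Real.exp g)) ≤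
      (t - g) ^ 2 / 8 := by
  have hc : 0 < 1 - c := by linarith
  have hexp : Real.exp g = c / (1 - c) := by rw [← hg, Real.exp_log (by positivity)]
  have e1 : 1 + Real.exp g = 1 / (1 - c) := by rw [hexp]; field_simp; ring
  have hpos : 0 < 1 - c + c * Real.exp (t - g) := by positivity
  have e2 : 1 + Real.exp t = (1 - c + c * Real.exp (t - g)) / (1 - c) := by
    have : Real.exp t = c / (1 - c) * Real.exp (t - g) := by
      rw [← hexp, ← Real.exp_add]; congr 1; ring
    rw [this]; field_simp
  rw [e1, e2, Real.log_div hpos.ne' hc.ne', Real.log_div one_ne_zero hc.ne', Real.log_one]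
  linarith [log_bernoulli_mgf_le h0 h1 (t - g)]

variable {n L : ℕ}

theorem logistic_nonneg {c : ℝ} (h0 : 0 ≤ c) (h1 : c ≤ 1) (t : ℝ) :
    0 ≤ -c * t + Real.log (1 + Real.exp t) := by
  have h2 : 0 ≤ Real.log (1 + Real.exp t) := Real.log_nonneg (by linarith [Real.exp_pos t])
  have h3 : t ≤ Real.log (1 + Real.exp t) := by
    rw [Real.le_log_iff_exp_le (by positivity)]; linarith
  rcases le_or_gt t 0 with h | h <;> nlinarith

theorem logisticLoss_nonneg {c : Fin n → ℝ} (hc : ∀ i, 0 ≤ c i ∧ c i ≤ 1) (t : Fin n → ℝ) :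
    0 ≤ logisticLoss c t :=
  mul_nonneg (by positivity) (Finset.sum_nonneg fun i _ => logistic_nonneg (hc i).1 (hc i).2 _)

theorem excessRisk_zero_le (hn : 1 ≤ n) {c : Fin n → ℝ} (hc : ∀ i, 0 ≤ c i ∧ c i ≤ 1)
    (S : Matrix (Fin n) (Fin L) ℝ) (g : Fin n → ℝ) : excessRisk S c g 0 ≤ Real.log 2 := by
  have h := logisticLoss_nonneg hc g
  have hn0 : (n : ℝ) ≠ 0 := by exact_mod_cast (by omega : n ≠ 0)
  have h2 : logisticLoss c (S.mulVec (0 : EuclideanSpace ℝ (Fin L)).ofLp) = Real.log 2 := by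
    simp [logisticLoss, hn0]
    norm_num
  rw [excessRisk, h2]; linarith

theorem excessRisk_le_sq {pr f γ : Fin n → ℝ}
    (hpr : ∀ i, 0 < pr i ∧ pr i < 1 ∧ Real.log (pr i / (1 - pr i)) = f i + γ i)
    (S : Matrix (Fin n) (Fin L) ℝ) (b : EuclideanSpace ℝ (Fin L)) :
    excessRisk S pr (fun i => f i + γ i) b ≤
      1 / (n : ℝ) * ∑ i, (1 / 4 * (S.mulVec b.ofLp i - f i) ^ 2 + 1 / 4 * γ i ^ 2) := by
  rw [excessRisk, logisticLoss, logisticLoss, ← mul_sub, ← Finset.sum_sub_distrib]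
  refine mul_le_mul_of_nonneg_left (Finset.sum_le_sum fun i _ => ?_) (by positivity)
  refine (logistic_sub_le (hpr i).1 (hpr i).2.1 (hpr i).2.2 _).trans ?_
  -- Uses `(x - γ)² ≤ 2x² + 2γ²`, which turns the constant 1/8 into 1/4.
  nlinarith [sq_nonneg (S.mulVec b.ofLp i - f i + γ i)]

/-- The score `Sᵀ (Y - p)`. -/
noncomputable def score (S : Matrix (Fin n) (Fin L) ℝ) (pr : Fin n → ℝ) (y : Fin n → Bool) :
    EuclideanSpace ℝ (Fin L) :=
  WithLp.toLp 2 fun l => ∑ i, (label (y i) - pr i) * S i l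

theorem inner_score (S : Matrix (Fin n) (Fin L) ℝ) (pr : Fin n → ℝ) (y : Fin n → Bool)
    (b : EuclideanSpace ℝ (Fin L)) :
    ∑ i, (label (y i) - pr i) * S.mulVec b.ofLp i = inner ℝ (score S pr y) b := by
  simp only [score, PiLp.inner_apply, RCLike.inner_apply, conj_trivial, Matrix.mulVec, dotProduct,
    Finset.mul_sum]
  rw [Finset.sum_comm]
  refine Finset.sum_congr rfl fun l _ => Finset.sum_congr rfl fun i _ => by ring

/-- Responses enter the loss linearly, so exchanging labels for probabilities costs only a linear
functional of `b`. -/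
theorem logisticLoss_eq_add (S : Matrix (Fin n) (Fin L) ℝ) (pr : Fin n → ℝ) (y : Fin n → Bool)
    (b : EuclideanSpace ℝ (Fin L)) :
    logisticLoss pr (S.mulVec b.ofLp) =
      logisticLoss (fun i => label (y i)) (S.mulVec b.ofLp) +
        1 / (n : ℝ) * inner ℝ (score S pr y) b := by
  rw [← inner_score, logisticLoss, logisticLoss, ← mul_add, ← Finset.sum_add_distrib]
  congr 1
  exact Finset.sum_congr rfl fun i _ => by ring

/-- The basic inequality for the constrained minimiser. -/
theorem excessRisk_le_of_isConstrainedLogistic {S : Matrix (Fin n) (Fin L) ℝ} (pr g : Fin n → ℝ)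
    {y : Fin n → Bool} {r : ℝ} {b b₀ : EuclideanSpace ℝ (Fin L)}
    (hb : IsConstrainedLogistic S y r b) (hb₀ : ‖b₀‖ ^ 2 ≤ r) :
    excessRisk S pr g b ≤ excessRisk S pr g b₀ +
      1 / (n : ℝ) * (Real.sqrt r * ‖score S pr y‖ -
        ∑ i, (label (y i) - pr i) * S.mulVec b₀.ofLp i) := by
  have h1 := hb.2 b₀ hb₀
  have h2 : inner ℝ (score S pr y) b ≤ Real.sqrt r * ‖score S pr y‖ := by
    refine (real_inner_le_norm _ _).trans ?_
    rw [mul_comm]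
    exact mul_le_mul_of_nonneg_right (Real.le_sqrt_of_sq_le hb.1) (norm_nonneg _)
  have h3 : 1 / (n : ℝ) * inner ℝ (score S pr y) b ≤
      1 / (n : ℝ) * (Real.sqrt r * ‖score S pr y‖) :=
    mul_le_mul_of_nonneg_left h2 (by positivity)
  rw [inner_score, mul_sub, excessRisk, excessRisk, logisticLoss_eq_add S pr y b,
    logisticLoss_eq_add S pr y b₀]
  linarith

theorem sum_bool_weight (c : ℝ) (f : Bool → ℝ) :
    ∑ y : Bool, (if y then c else 1 - c) * f y = c * f true + (1 - c) * f false := by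
  simp

theorem bernoulli_weight_sum (pr : Fin n → ℝ) (i : Fin n) :
    ∑ y : Bool, (if y then pr i else 1 - pr i) = 1 := by simp

theorem label_noise_mean (pr : Fin n → ℝ) (t : Fin n → ℝ) :
    ∑ y : Fin n → Bool, (∏ i, if y i then pr i else 1 - pr i) *
      ∑ i, (label (y i) - pr i) * t i = 0 := by
  rw [pi_expect_sum (μ := fun i (y : Bool) => if y then pr i else 1 - pr i)
    (g := fun i y => (label y - pr i) * t i) (bernoulli_weight_sum pr)]
  refine Finset.sum_eq_zero fun i _ => ?_
  rw [sum_bool_weight]; simp [label]; ring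

theorem score_norm_sq_mean_le {S : Matrix (Fin n) (Fin L) ℝ} (hS : ∀ i l, S i l ^ 2 ≤ 1)
    {pr : Fin n → ℝ} (hpr : ∀ i, 0 ≤ pr i ∧ pr i ≤ 1) :
    ∑ y : Fin n → Bool, (∏ i, if y i then pr i else 1 - pr i) * ‖score S pr y‖ ^ 2 ≤
      L * ∑ i, pr i * (1 - pr i) := by
  simp_rw [EuclideanSpace.real_norm_sq_eq, Finset.mul_sum (Finset.univ : Finset (Fin L))]
  rw [Finset.sum_comm]
  have hl : ∀ l : Fin L, ∑ y : Fin n → Bool, (∏ i, if y i then pr i else 1 - pr i) *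
      (score S pr y) l ^ 2 ≤ ∑ i, pr i * (1 - pr i) := by
    intro l
    simp only [score]
    rw [pi_expect_sum_sq (μ := fun i (y : Bool) => if y then pr i else 1 - pr i)
      (g := fun i y => (label y - pr i) * S i l) (bernoulli_weight_sum pr) fun i => by
        rw [sum_bool_weight]; simp [label]; ring]
    refine Finset.sum_le_sum fun i _ => ?_
    rw [sum_bool_weight]
    have h := mul_nonneg (hpr i).1 (sub_nonneg.2 (hpr i).2)
    calc _ = pr i * (1 - pr i) * S i l ^ 2 := by simp [label]; ring
      _ ≤ pr i * (1 - pr i) * 1 := mul_le_mul_of_nonneg_left (hS i l) h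
      _ = _ := mul_one _
  refine (Finset.sum_le_sum fun l _ => hl l).trans_eq ?_
  simp

end Logistic

/-! ### Expected risk over hashing and labels. -/

section ExpectedRisk

variable {n p L a : ℕ} {X : Matrix (Fin n) (Fin p) ℝ}

/-- The oracle vector, replaced by zero if it violates the constraint. -/
noncomputable def truncOracle (a : ℕ) (θ : EuclideanSpace ℝ (Fin p))
    (Θ : Matrix (Fin p) (Fin p) ℝ) (r : ℝ)
    (u : Fin L → Equiv.Perm (Fin p) × (Fin p → ℤˣ)) : EuclideanSpace ℝ (Fin L) :=
  if r < ‖oracle (fun σ k => mainCoef a θ σ k + interCoef a Θ σ k) u‖ ^ 2 then 0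
  else oracle (fun σ k => mainCoef a θ σ k + interCoef a Θ σ k) u

theorem truncOracle_norm_sq_le (θ : EuclideanSpace ℝ (Fin p)) (Θ : Matrix (Fin p) (Fin p) ℝ)
    {r : ℝ} (hr : 0 ≤ r) (u : Fin L → Equiv.Perm (Fin p) × (Fin p → ℤˣ)) :
    ‖truncOracle a θ Θ r u‖ ^ 2 ≤ r := by
  rw [truncOracle]
  split_ifs with h
  · simpa using hr
  · exact not_lt.1 h

/-- Where the oracle is feasible, the quadratic bound and its mean squared error apply; elsewhere
the zero vector costs at most `log 2`, on an event of weight at most `rho2`. -/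
theorem truncOracle_excessRisk_mean_le (hn : 1 ≤ n) (hL : 1 ≤ L) (hap : a + 1 ≤ p) (hp : 2 ≤ p)
    (hX : ∀ i k, |X i k| ≤ 1) (hXq : ∀ i, (rowSupport X i).card = a + 1)
    (θ : EuclideanSpace ℝ (Fin p)) (Θ : Matrix (Fin p) (Fin p) ℝ) (γ : EuclideanSpace ℝ (Fin n))
    {pr : Fin n → ℝ} (hpr : ∀ i, 0 < pr i ∧ pr i < 1 ∧
      Real.log (pr i / (1 - pr i)) = interactionSignal X θ Θ i + γ i) {η : ℝ} (hη : 0 < η) :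
    ∑ u : Fin L → Equiv.Perm (Fin p) × (Fin p → ℤˣ),
      (∏ _l : Fin L, (1 / (p.factorial : ℝ) * ∏ _k : Fin p, (1 / 2 : ℝ))) *
      excessRisk (hashMatrix X u) pr (fun i => interactionSignal X θ Θ i + γ i)
        (truncOracle a θ Θ ((1 + η) * ((2 - ((a + 1 : ℕ) : ℝ) / p) * ((a + 1 : ℕ) : ℝ) *
        interactionNorm (a + 1) θ Θ ^ 2 / L)) u) ≤
      (2 - ((a + 1 : ℕ) : ℝ) / p) * ((a + 1 : ℕ) : ℝ) * interactionNorm (a + 1) θ Θ ^ 2 / (4 * L) +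
        ‖γ‖ ^ 2 / (4 * n) + Real.log 2 * rho2 p (a + 1) L η := by
  have htail := oracle_norm_tail (L := L) hL hap hp hη θ Θ
  have hmse := fun i => oracle_mean_sq_error (L := L) hL hap hp hX (hXq i) θ Θ
  have hn0 : (0 : ℝ) < n := by exact_mod_cast hn
  have hL0 : (0 : ℝ) < L := by exact_mod_cast hL
  set B := (2 - ((a + 1 : ℕ) : ℝ) / p) * ((a + 1 : ℕ) : ℝ) * interactionNorm (a + 1) θ Θ ^ 2
  set c : ℝ := ∏ _l : Fin L, (1 / (p.factorial : ℝ) * ∏ _k : Fin p, (1 / 2 : ℝ))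
  have hc0 : 0 ≤ c := by positivity
  have hcsum : ∑ _u : Fin L → Equiv.Perm (Fin p) × (Fin p → ℤˣ), c = 1 :=
    pi_weight_sum (ι := Fin L) (μ := fun _ _ => _) fun _ => hash_weight_sum
  set b : (Fin L → Equiv.Perm (Fin p) × (Fin p → ℤˣ)) → EuclideanSpace ℝ (Fin L) :=
    oracle fun σ k => mainCoef a θ σ k + interCoef a Θ σ k with hb
  set f := interactionSignal X θ Θ
  have hpr' : ∀ i, 0 ≤ pr i ∧ pr i ≤ 1 := fun i => ⟨(hpr i).1.le, (hpr i).2.1.le⟩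
  have hlog : 0 ≤ Real.log 2 := Real.log_nonneg (by norm_num)
  have hpt : ∀ u, excessRisk (hashMatrix X u) pr (fun i => f i + γ i)
      (truncOracle a θ Θ ((1 + η) * (B / L)) u) ≤
      Real.log 2 * (if (1 + η) * (B / L) < ‖b u‖ ^ 2 then 1 else 0) +
      (∑ i, 1 / (4 * (n : ℝ)) * ((hashMatrix X u).mulVec (b u).ofLp i - f i) ^ 2 +
        ‖γ‖ ^ 2 / (4 * n)) := by
    intro u
    rw [truncOracle, ← hb]
    have hrest : 0 ≤ ∑ i, 1 / (4 * (n : ℝ)) * ((hashMatrix X u).mulVec (b u).ofLp i - f i) ^ 2 +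
        ‖γ‖ ^ 2 / (4 * n) :=
      add_nonneg (Finset.sum_nonneg fun i _ => by positivity) (by positivity)
    split_ifs with h
    · rw [mul_one]
      linarith [excessRisk_zero_le hn hpr' (hashMatrix X u) fun i => f i + γ i]
    · rw [mul_zero, zero_add]
      refine (excessRisk_le_sq hpr _ _).trans_eq ?_
      rw [EuclideanSpace.real_norm_sq_eq, Finset.sum_div, ← Finset.sum_add_distrib, Finset.mul_sum]
      refine Finset.sum_congr rfl fun i _ => ?_
      field_simp
  have hmse' : ∑ i, 1 / (4 * (n : ℝ)) * ∑ u : Fin L → Equiv.Perm (Fin p) × (Fin p → ℤˣ),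
      c * ((hashMatrix X u).mulVec (b u).ofLp i - f i) ^ 2 ≤ B / (4 * L) := by
    calc _ ≤ ∑ _i : Fin n, 1 / (4 * (n : ℝ)) * (B / L) :=
          Finset.sum_le_sum fun i _ => mul_le_mul_of_nonneg_left (hmse i) (by positivity)
      _ = _ := by
          rw [Finset.sum_const, Finset.card_univ, Fintype.card_fin, nsmul_eq_mul]; field_simp
  calc _ ≤ ∑ u, c * (Real.log 2 * (if (1 + η) * (B / L) < ‖b u‖ ^ 2 then 1 else 0) +
      (∑ i, 1 / (4 * (n : ℝ)) * ((hashMatrix X u).mulVec (b u).ofLp i - f i) ^ 2 +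
        ‖γ‖ ^ 2 / (4 * n))) :=
        Finset.sum_le_sum fun u _ => mul_le_mul_of_nonneg_left (hpt u) hc0
    _ = Real.log 2 * (∑ u, c * (if (1 + η) * (B / L) < ‖b u‖ ^ 2 then 1 else 0)) +
      (∑ i, 1 / (4 * (n : ℝ)) * ∑ u, c * ((hashMatrix X u).mulVec (b u).ofLp i - f i) ^ 2) +
        ‖γ‖ ^ 2 / (4 * n) * ∑ _u : Fin L → Equiv.Perm (Fin p) × (Fin p → ℤˣ), c := by
        simp_rw [mul_add, Finset.sum_add_distrib, Finset.mul_sum]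
        rw [Finset.sum_comm (s := (Finset.univ : Finset (Fin n))), ← add_assoc]
        refine congrArg₂ _ (congrArg₂ _ ?_ ?_) ?_
        · exact Finset.sum_congr rfl fun u _ => by ring
        · exact Finset.sum_congr rfl fun u _ => Finset.sum_congr rfl fun i _ => by ring
        · exact Finset.sum_congr rfl fun u _ => by ring
    _ ≤ Real.log 2 * rho2 p (a + 1) L η + B / (4 * L) + ‖γ‖ ^ 2 / (4 * n) * 1 := by
        rw [hcsum]
        gcongr
    _ = _ := by ring

/-- A pointwise upper bound for the excess risk of the constrained minimiser: the excess risk of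
the truncated oracle plus the noise terms. -/
noncomputable def riskBound (X : Matrix (Fin n) (Fin p) ℝ) (pr g : Fin n → ℝ) (r τ : ℝ)
    (b₀ : (Fin L → Equiv.Perm (Fin p) × (Fin p → ℤˣ)) → EuclideanSpace ℝ (Fin L))
    (t : (Fin L → Equiv.Perm (Fin p) × (Fin p → ℤˣ)) × (Fin n → Bool)) : ℝ :=
  excessRisk (hashMatrix X t.1) pr g (b₀ t.1) +
    1 / (n : ℝ) * (Real.sqrt r * ((‖score (hashMatrix X t.1) pr t.2‖ ^ 2 / τ + τ) / 2) -
      ∑ i, (label (t.2 i) - pr i) * (hashMatrix X t.1).mulVec (b₀ t.1).ofLp i)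

/-- The inequality `x ≤ (x²/τ + τ)/2` trades the norm of the score for its square, whose mean is
explicit. The bound no longer involves the minimiser. -/
theorem excessRisk_le_riskBound {pr g : Fin n → ℝ} {r τ : ℝ} (hτ : 0 < τ)
    {b₀ : (Fin L → Equiv.Perm (Fin p) × (Fin p → ℤˣ)) → EuclideanSpace ℝ (Fin L)}
    {u : Fin L → Equiv.Perm (Fin p) × (Fin p → ℤˣ)} {y : Fin n → Bool}
    {b : EuclideanSpace ℝ (Fin L)} (hb : IsConstrainedLogistic (hashMatrix X u) y r b)
    (hb₀ : ‖b₀ u‖ ^ 2 ≤ r) :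
    excessRisk (hashMatrix X u) pr g b ≤ riskBound X pr g r τ b₀ (u, y) := by
  refine (excessRisk_le_of_isConstrainedLogistic pr g hb hb₀).trans ?_
  rw [riskBound]
  have h : ‖score (hashMatrix X u) pr y‖ ≤ (‖score (hashMatrix X u) pr y‖ ^ 2 / τ + τ) / 2 := by
    rw [le_div_iff₀ two_pos, div_add' _ _ _ hτ.ne', le_div_iff₀ hτ]
    nlinarith [sq_nonneg (‖score (hashMatrix X u) pr y‖ - τ)]
  gcongr

/-- The comparison vector depends only on the hashing, so its linear noise term averages to zero
over the labels. Since `τ ^ 2` bounds the mean squared score, the remaining noise factor has mean at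
most `τ`. -/
theorem riskBound_mean_le (hX : ∀ i k, |X i k| ≤ 1)
    (hXq : ∀ i, (rowSupport X i).Nonempty) {pr g : Fin n → ℝ} (hpr : ∀ i, 0 ≤ pr i ∧ pr i ≤ 1)
    {r τ : ℝ} (hτ : 0 < τ) (hτ2 : τ ^ 2 = L * ∑ i, pr i * (1 - pr i))
    (b₀ : (Fin L → Equiv.Perm (Fin p) × (Fin p → ℤˣ)) → EuclideanSpace ℝ (Fin L)) :
    ∑ t : (Fin L → Equiv.Perm (Fin p) × (Fin p → ℤˣ)) × (Fin n → Bool),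
      (∏ _l : Fin L, (1 / (p.factorial : ℝ) * ∏ _k : Fin p, (1 / 2 : ℝ))) *
        (∏ i, if t.2 i then pr i else 1 - pr i) * riskBound X pr g r τ b₀ t ≤
      ∑ u : Fin L → Equiv.Perm (Fin p) × (Fin p → ℤˣ),
        (∏ _l : Fin L, (1 / (p.factorial : ℝ) * ∏ _k : Fin p, (1 / 2 : ℝ))) *
        excessRisk (hashMatrix X u) pr g (b₀ u) + Real.sqrt r * τ / n := by
  set c : ℝ := ∏ _l : Fin L, (1 / (p.factorial : ℝ) * ∏ _k : Fin p, (1 / 2 : ℝ))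
  have hc0 : 0 ≤ c := by positivity
  have hcsum : ∑ _u : Fin L → Equiv.Perm (Fin p) × (Fin p → ℤˣ), c = 1 :=
    pi_weight_sum (ι := Fin L) (μ := fun _ _ => _) fun _ => hash_weight_sum
  have hw : ∑ y : Fin n → Bool, (∏ i, if y i then pr i else 1 - pr i) = 1 :=
    pi_weight_sum (ι := Fin n) (α := Bool) (bernoulli_weight_sum pr)
  rw [Fintype.sum_prod_type]
  have hu : ∀ u : Fin L → Equiv.Perm (Fin p) × (Fin p → ℤˣ), ∑ y : Fin n → Bool,
      c * (∏ i, if y i then pr i else 1 - pr i) * riskBound X pr g r τ b₀ (u, y) ≤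
      c * excessRisk (hashMatrix X u) pr g (b₀ u) + c * (Real.sqrt r * τ / n) := by
    intro u
    simp_rw [mul_assoc]
    rw [← Finset.mul_sum, ← mul_add]
    refine mul_le_mul_of_nonneg_left ?_ hc0
    have hS : ∀ i l, hashMatrix X u i l ^ 2 ≤ 1 := fun i l => by
      rw [hashMatrix_apply]; exact hashEntry_sq_le hX (hXq i) _
    have h1 := score_norm_sq_mean_le hS hpr
    have h2 := label_noise_mean pr ((hashMatrix X u).mulVec (b₀ u).ofLp)
    have e : ∀ y : Fin n → Bool, (∏ i, if y i then pr i else 1 - pr i) *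
        riskBound X pr g r τ b₀ (u, y) =
        (excessRisk (hashMatrix X u) pr g (b₀ u) + 1 / (n : ℝ) * (Real.sqrt r * (τ / 2))) *
          (∏ i, if y i then pr i else 1 - pr i) +
        1 / (n : ℝ) * (Real.sqrt r / (2 * τ)) *
          ((∏ i, if y i then pr i else 1 - pr i) * ‖score (hashMatrix X u) pr y‖ ^ 2) -
        1 / (n : ℝ) * ((∏ i, if y i then pr i else 1 - pr i) *
          ∑ i, (label (y i) - pr i) * (hashMatrix X u).mulVec (b₀ u).ofLp i) := by
      intro y; rw [riskBound]; field_simp; ring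
    rw [Finset.sum_congr rfl fun y _ => e y, Finset.sum_sub_distrib, Finset.sum_add_distrib,
      ← Finset.mul_sum, ← Finset.mul_sum, ← Finset.mul_sum, hw, h2, mul_zero, sub_zero, mul_one]
    rw [← hτ2] at h1
    calc _ ≤ excessRisk (hashMatrix X u) pr g (b₀ u) + 1 / (n : ℝ) * (Real.sqrt r * (τ / 2)) +
        1 / (n : ℝ) * (Real.sqrt r / (2 * τ)) * τ ^ 2 := by gcongr
      _ = _ := by field_simp; ring
  refine (Finset.sum_le_sum fun u _ => hu u).trans_eq ?_
  rw [Finset.sum_add_distrib, ← Finset.sum_mul, hcsum, one_mul]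

end ExpectedRisk

/-! ### Transfer to the probability space. -/

section Sample

variable {n p L : ℕ}

/-- The hashing randomness and the labels as one variable with finitely many values. -/
def samplePair {Ω : Type*} (π : Ω → Fin L → Equiv.Perm (Fin p)) (Ψ : Ω → Fin p → Fin L → ℤˣ)
    (Y : Ω → Fin n → Bool) (ω : Ω) :
    (Fin L → Equiv.Perm (Fin p) × (Fin p → ℤˣ)) × (Fin n → Bool) :=
  (fun l => (π ω l, fun k => Ψ ω k l), Y ω)

theorem samplePair_preimage {Ω : Type*} {π : Ω → Fin L → Equiv.Perm (Fin p)}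
    {Ψ : Ω → Fin p → Fin L → ℤˣ} {Y : Ω → Fin n → Bool}
    (t : (Fin L → Equiv.Perm (Fin p) × (Fin p → ℤˣ)) × (Fin n → Bool)) :
    samplePair π Ψ Y ⁻¹' {t} = {ω | π ω = (fun l => (t.1 l).1) ∧
      Ψ ω = (fun k l => (t.1 l).2 k) ∧ Y ω = t.2} := by
  ext ω
  obtain ⟨u, y⟩ := t
  simp only [samplePair, Set.mem_preimage, Set.mem_singleton_iff, funext_iff,
    Set.mem_ofPred_eq, Prod.ext_iff]
  constructor
  · rintro ⟨h1, h2⟩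
    exact ⟨fun l => (h1 l).1, fun k l => (h1 l).2 k, h2⟩
  · rintro ⟨h1, h2, h3⟩
    exact ⟨fun l => ⟨h1 l, fun k => h2 k l⟩, h3⟩

variable {Ω : Type*} [MeasurableSpace Ω] {P : Measure Ω} {pr : Fin n → ℝ} {π : Ω → Fin L → Equiv.Perm (Fin p)} {Ψ : Ω → Fin p → Fin L → ℤˣ}
  {Y : Ω → Fin n → Bool}

theorem samplePair_measurable (h : IsHashedBernoulliSample P pr π Ψ Y) :
    Measurable[_, ⊤] (samplePair π Ψ Y) := by
  let _ : MeasurableSpace ((Fin L → Equiv.Perm (Fin p) × (Fin p → ℤˣ)) × (Fin n → Bool)) := ⊤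
  refine measurable_to_countable' fun t => ?_
  rw [samplePair_preimage]
  exact h.measurableSet_eq _ _ _

theorem integral_samplePair [IsProbabilityMeasure P] (h : IsHashedBernoulliSample P pr π Ψ Y)
    (G : (Fin L → Equiv.Perm (Fin p) × (Fin p → ℤˣ)) × (Fin n → Bool) → ℝ) :
    Integrable (fun ω => G (samplePair π Ψ Y ω)) P ∧
    ∫ ω, G (samplePair π Ψ Y ω) ∂P = ∑ t,
      (∏ _l : Fin L, (1 / (p.factorial : ℝ) * ∏ _k : Fin p, (1 / 2 : ℝ))) *
        (∏ i, if t.2 i then pr i else 1 - pr i) * G t := by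
  let _ : MeasurableSpace ((Fin L → Equiv.Perm (Fin p) × (Fin p → ℤˣ)) × (Fin n → Bool)) := ⊤
  have : MeasurableSingletonClass
    ((Fin L → Equiv.Perm (Fin p) × (Fin p → ℤˣ)) × (Fin n → Bool)) := ⟨fun _ => trivial⟩
  have hT : Measurable (samplePair π Ψ Y) := samplePair_measurable h
  have : IsProbabilityMeasure (P.map (samplePair π Ψ Y)) :=
    Measure.isProbabilityMeasure_map hT.aemeasurable
  have hG : Measurable G := fun _ _ => trivial
  have hint : Integrable G (P.map (samplePair π Ψ Y)) := Integrable.of_finite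
  refine ⟨hint.comp_measurable hT, ?_⟩
  rw [← integral_map hT.aemeasurable hG.aestronglyMeasurable, integral_fintype hint]
  refine Finset.sum_congr rfl fun t _ => ?_
  rw [map_measureReal_apply hT trivial, samplePair_preimage, h.law, smul_eq_mul,
    Finset.prod_mul_distrib, Finset.prod_comm (s := (Finset.univ : Finset (Fin p)))]

theorem measurable_excessRisk (S : Matrix (Fin n) (Fin L) ℝ) (pr g : Fin n → ℝ) :
    Measurable fun b : EuclideanSpace ℝ (Fin L) => excessRisk S pr g b := by
  unfold excessRisk logisticLoss Matrix.mulVec dotProduct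
  fun_prop

/-- Needed because the minimiser is only a measurable function on `Ω`, not a function of the finite
sample. -/
theorem measurable_apply_of_finite {T E : Type*} [Finite T] [MeasurableSpace E] {f : Ω → T}
    (hf : Measurable[_, ⊤] f) {b : Ω → E} (hb : Measurable b) {F : T → E → ℝ}
    (hF : ∀ t, Measurable (F t)) : Measurable fun ω => F (f ω) (b ω) := by
  let _ : MeasurableSpace T := ⊤
  have : MeasurableSingletonClass T := ⟨fun _ => trivial⟩
  have h : Measurable fun x : T × E => F x.1 x.2 := measurable_from_prod_countable_right hF
  exact h.comp (Measurable.prodMk (by exact hf) hb)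

theorem excessRisk_aestronglyMeasurable (h : IsHashedBernoulliSample P pr π Ψ Y)
    (X : Matrix (Fin n) (Fin p) ℝ) (g : Fin n → ℝ) {bhat : Ω → EuclideanSpace ℝ (Fin L)}
    (hb : Measurable bhat) :
    AEStronglyMeasurable (fun ω => excessRisk (signHash X (π ω) (Ψ ω)) pr g (bhat ω)) P :=
  (measurable_apply_of_finite (samplePair_measurable h) hb
    fun t => measurable_excessRisk (hashMatrix X t.1) pr g).aestronglyMeasurable

end Sample

/-! ### The risk bound for a ball enlarged by any factor `c ≥ 1`, and the theorem. -/

theorem expected_excessRisk_le {n p q L : ℕ} (hn : 1 ≤ n) (hp : 2 ≤ p) (hq : 1 ≤ q) (hL : 1 ≤ L)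
    (X : Matrix (Fin n) (Fin p) ℝ) (hX : ∀ i k, |X i k| ≤ 1)
    (hXq : ∀ i, (rowSupport X i).card = q)
    (θ : EuclideanSpace ℝ (Fin p)) (Θ : Matrix (Fin p) (Fin p) ℝ)
    (γ : EuclideanSpace ℝ (Fin n)) (pr : Fin n → ℝ)
    (hpr : ∀ i, 0 < pr i ∧ pr i < 1 ∧
      Real.log (pr i / (1 - pr i)) = interactionSignal X θ Θ i + γ i)
    {Ω : Type*} [MeasurableSpace Ω] (P : Measure Ω) [IsProbabilityMeasure P]
    (π : Ω → Fin L → Equiv.Perm (Fin p)) (Ψ : Ω → Fin p → Fin L → ℤˣ) (Y : Ω → Fin n → Bool)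
    (hsample : IsHashedBernoulliSample P pr π Ψ Y)
    (η : ℝ) (hη : 0 < η) (bhat : Ω → EuclideanSpace ℝ (Fin L)) (hbhat : Measurable bhat)
    {c : ℝ} (hc : 1 ≤ c)
    (hmin : ∀ᵐ ω ∂P, IsConstrainedLogistic (signHash X (π ω) (Ψ ω)) (Y ω)
      (c * ((1 + η) * ((2 - (q : ℝ) / p) * q * interactionNorm q θ Θ ^ 2 / L))) (bhat ω)) :
    Integrable (fun ω => excessRisk (signHash X (π ω) (Ψ ω)) pr
      (fun i => interactionSignal X θ Θ i + γ i) (bhat ω)) P ∧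
    ∫ ω, excessRisk (signHash X (π ω) (Ψ ω)) pr
      (fun i => interactionSignal X θ Θ i + γ i) (bhat ω) ∂P ≤
      Real.sqrt ((2 - (q : ℝ) / p) * q) * interactionNorm q θ Θ *
          ((Real.sqrt c * Real.sqrt ((1 + η) * ((1 / (n : ℝ)) * ∑ i, pr i * (1 - pr i))) +
            Lstar n q θ Θ / (4 * L)) / Real.sqrt n) +
        ‖γ‖ ^ 2 / (4 * n) + Real.log 2 * rho2 p q L η := by
  -- Here `a` counts the non-zero entries of a row other than the hashed one.
  obtain ⟨a, rfl⟩ : ∃ a, q = a + 1 := ⟨q - 1, by omega⟩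
  have hap : a + 1 ≤ p := by
    have := Finset.card_le_univ (rowSupport X ⟨0, hn⟩)
    rwa [hXq, Fintype.card_fin] at this
  have hp0 : (0 : ℝ) < p := by exact_mod_cast (by omega : 0 < p)
  have hn0 : (0 : ℝ) < n := by exact_mod_cast hn
  have hL0 : (0 : ℝ) < L := by exact_mod_cast hL
  have hδ : ((a + 1 : ℕ) : ℝ) / p ≤ 1 := (div_le_one hp0).2 (by exact_mod_cast hap)
  have hpr' : ∀ i, 0 ≤ pr i ∧ pr i ≤ 1 := fun i => ⟨(hpr i).1.le, (hpr i).2.1.le⟩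
  have horacle := truncOracle_excessRisk_mean_le (L := L) hn hL hap hp hX hXq θ Θ γ hpr hη
  have hℓ : 0 ≤ interactionNorm (a + 1) θ Θ := by unfold interactionNorm; positivity
  rw [Lstar]
  set ℓ := interactionNorm (a + 1) θ Θ
  set m : ℝ := (2 - ((a + 1 : ℕ) : ℝ) / p) * ((a + 1 : ℕ) : ℝ) with hm
  have hm0 : 0 ≤ m := mul_nonneg (by linarith) (Nat.cast_nonneg _)
  set r₁ : ℝ := (1 + η) * (m * ℓ ^ 2 / L) with hr₁
  have hr₁0 : 0 ≤ r₁ := by positivity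
  set V : ℝ := ∑ i, pr i * (1 - pr i)
  have hV : 0 < V := Finset.sum_pos
    (fun i _ => mul_pos (hpr i).1 (sub_pos.2 (hpr i).2.1)) ⟨⟨0, hn⟩, Finset.mem_univ _⟩
  set τ := Real.sqrt (L * V)
  have hτ : 0 < τ := Real.sqrt_pos.2 (by positivity)
  have hτ2 : τ ^ 2 = L * V := Real.sq_sqrt (by positivity)
  set g : Fin n → ℝ := fun i => interactionSignal X θ Θ i + γ i
  set b₀ : (Fin L → Equiv.Perm (Fin p) × (Fin p → ℤˣ)) → EuclideanSpace ℝ (Fin L) :=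
    truncOracle a θ Θ r₁
  have hle : ∀ᵐ ω ∂P, excessRisk (signHash X (π ω) (Ψ ω)) pr g (bhat ω) ≤
      riskBound X pr g (c * r₁) τ b₀ (samplePair π Ψ Y ω) := by
    filter_upwards [hmin] with ω hω
    exact excessRisk_le_riskBound (u := (samplePair π Ψ Y ω).1) hτ hω
      ((truncOracle_norm_sq_le θ Θ hr₁0 _).trans (le_mul_of_one_le_left hr₁0 hc))
  obtain ⟨hGi, hG⟩ := integral_samplePair hsample (riskBound X pr g (c * r₁) τ b₀)
  have hint : Integrable (fun ω => excessRisk (signHash X (π ω) (Ψ ω)) pr g (bhat ω)) P := by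
    -- The excess risk lies between minus the loss at the true log-odds and the finitely valued
    -- `riskBound`.
    refine Integrable.mono' (hGi.abs.add (integrable_const |logisticLoss pr g|))
      (excessRisk_aestronglyMeasurable hsample X g hbhat) ?_
    filter_upwards [hle] with ω hω
    have h1 : -logisticLoss pr g ≤ excessRisk (signHash X (π ω) (Ψ ω)) pr g (bhat ω) := by
      rw [excessRisk]
      linarith [logisticLoss_nonneg hpr' ((signHash X (π ω) (Ψ ω)).mulVec (bhat ω).ofLp)]
    rw [Real.norm_eq_abs, abs_le]
    simp only [Pi.add_apply]
    have h2 := le_abs_self (logisticLoss pr g)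
    have h3 := abs_nonneg (logisticLoss pr g)
    have h4 := le_abs_self (riskBound X pr g (c * r₁) τ b₀ (samplePair π Ψ Y ω))
    have h5 := abs_nonneg (riskBound X pr g (c * r₁) τ b₀ (samplePair π Ψ Y ω))
    constructor <;> linarith
  refine ⟨hint, (integral_mono_ae hint hGi hle).trans ?_⟩
  rw [hG]
  have hne : ∀ i, (rowSupport X i).Nonempty := fun i =>
    Finset.card_pos.1 (by rw [hXq i]; omega)
  refine (riskBound_mean_le hX hne hpr' hτ hτ2 b₀).trans ?_
  refine (add_le_add_left horacle _).trans_eq ?_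
  have hsn : Real.sqrt n ^ 2 = n := Real.sq_sqrt hn0.le
  have hsn0 : 0 < Real.sqrt n := Real.sqrt_pos.2 hn0
  have e1 : Real.sqrt (c * r₁) * τ / n = Real.sqrt m * ℓ *
      (Real.sqrt c * Real.sqrt ((1 + η) * ((1 / (n : ℝ)) * V)) / Real.sqrt n) := by
    have h : Real.sqrt (c * r₁) * τ = Real.sqrt m * ℓ *
        (Real.sqrt c * Real.sqrt ((1 + η) * ((1 / (n : ℝ)) * V))) * Real.sqrt n := by
      have hℓ2 : ℓ = Real.sqrt (ℓ ^ 2) := (Real.sqrt_sq hℓ).symm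
      rw [hℓ2, ← Real.sqrt_mul (by positivity), ← Real.sqrt_mul (by positivity),
        ← Real.sqrt_mul (by positivity), ← Real.sqrt_mul (by positivity),
        ← Real.sqrt_mul (by positivity)]
      congr 1
      rw [hr₁]
      field_simp
    rw [h, div_eq_iff hn0.ne']
    field_simp
    rw [hsn]
  have e2 : m * ℓ ^ 2 / (4 * L) =
      Real.sqrt m * ℓ * (Real.sqrt (m * n) * ℓ / (4 * L) / Real.sqrt n) := by
    have h : Real.sqrt m ^ 2 = m := Real.sq_sqrt hm0
    rw [Real.sqrt_mul hm0]
    field_simp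
    rw [h, mul_comm]
  rw [e1, e2]
  ring

end MinwiseHashing

theorem mainTheorem9 {n p q L : ℕ} (hn : 1 ≤ n) (hp : 3 ≤ p) (hq : 1 ≤ q) (hL : 1 ≤ L)
    (X : Matrix (Fin n) (Fin p) ℝ) (hX : ∀ i k, |X i k| ≤ 1)
    (hXq : ∀ i, (MinwiseHashing.rowSupport X i).card = q)
    (θ : EuclideanSpace ℝ (Fin p)) (Θ : Matrix (Fin p) (Fin p) ℝ) (hΘ : ∀ k, Θ k k = 0)
    (γ : EuclideanSpace ℝ (Fin n)) (pr : Fin n → ℝ)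
    (hpr : ∀ i, 0 < pr i ∧ pr i < 1 ∧
      Real.log (pr i / (1 - pr i)) = MinwiseHashing.interactionSignal X θ Θ i + γ i)
    {Ω : Type*} [MeasurableSpace Ω] (P : MeasureTheory.Measure Ω)
    [MeasureTheory.IsProbabilityMeasure P]
    (π : Ω → Fin L → Equiv.Perm (Fin p)) (Ψ : Ω → Fin p → Fin L → ℤˣ) (Y : Ω → Fin n → Bool)
    (hsample : MinwiseHashing.IsHashedBernoulliSample P pr π Ψ Y)
    (η : ℝ) (hη : 0 < η) (bhat : Ω → EuclideanSpace ℝ (Fin L)) (hbhat : Measurable bhat) :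
    ((∀ᵐ ω ∂P, MinwiseHashing.IsConstrainedLogistic
        (MinwiseHashing.signHash X (π ω) (Ψ ω)) (Y ω)
        ((1 + η) * (2 * (2 - (q : ℝ) / p) * q * MinwiseHashing.interactionNorm q θ Θ ^ 2 / L))
        (bhat ω)) →
      MeasureTheory.Integrable (fun ω => MinwiseHashing.excessRisk
        (MinwiseHashing.signHash X (π ω) (Ψ ω)) pr
        (fun i => MinwiseHashing.interactionSignal X θ Θ i + γ i) (bhat ω)) P ∧
      ∫ ω, MinwiseHashing.excessRisk (MinwiseHashing.signHash X (π ω) (Ψ ω)) pr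
        (fun i => MinwiseHashing.interactionSignal X θ Θ i + γ i) (bhat ω) ∂P ≤
        Real.sqrt ((2 - (q : ℝ) / p) * q) * MinwiseHashing.interactionNorm q θ Θ *
            ((Real.sqrt 2 * Real.sqrt ((1 + η) * ((1 / (n : ℝ)) * ∑ i, pr i * (1 - pr i))) +
              MinwiseHashing.Lstar n q θ Θ / (4 * L)) / Real.sqrt n) +
          ‖γ‖ ^ 2 / (4 * n) + Real.log 2 * MinwiseHashing.rho2 p q L η) ∧
    ((∀ᵐ ω ∂P, MinwiseHashing.IsConstrainedLogistic
        (MinwiseHashing.signHash X (π ω) (Ψ ω)) (Y ω)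
        ((1 + η) * ((2 - (q : ℝ) / p) * q * MinwiseHashing.interactionNorm q θ Θ ^ 2 / L))
        (bhat ω)) →
      MeasureTheory.Integrable (fun ω => MinwiseHashing.excessRisk
        (MinwiseHashing.signHash X (π ω) (Ψ ω)) pr
        (fun i => MinwiseHashing.interactionSignal X θ Θ i + γ i) (bhat ω)) P ∧
      ∫ ω, MinwiseHashing.excessRisk (MinwiseHashing.signHash X (π ω) (Ψ ω)) pr
        (fun i => MinwiseHashing.interactionSignal X θ Θ i + γ i) (bhat ω) ∂P ≤
        Real.sqrt ((2 - (q : ℝ) / p) * q) * MinwiseHashing.interactionNorm q θ Θ *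
            ((Real.sqrt ((1 + η) * ((1 / (n : ℝ)) * ∑ i, pr i * (1 - pr i))) +
              Real.sqrt 2 * MinwiseHashing.Lstar n q θ Θ / (4 * L)) / Real.sqrt n) +
          ‖γ‖ ^ 2 / (4 * n) + Real.log 2 * MinwiseHashing.rho2 p q L η) := by
  constructor
  · intro hmin
    refine MinwiseHashing.expected_excessRisk_le hn (by omega) hq hL X hX hXq θ Θ γ pr hpr P π Ψ Y
      hsample η hη bhat hbhat (c := 2) one_le_two (hmin.mono fun ω hω => ?_)
    convert hω using 1
    ring
  · intro hmin
    obtain ⟨hint, hle⟩ := MinwiseHashing.expected_excessRisk_le hn (by omega) hq hL X hX hXq θ Θ γ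
      pr hpr P π Ψ Y hsample η hη bhat hbhat (c := 1) le_rfl (hmin.mono fun ω hω => by
        rwa [one_mul])
    refine ⟨hint, hle.trans ?_⟩
    have hℓ : 0 ≤ MinwiseHashing.interactionNorm q θ Θ := by
      unfold MinwiseHashing.interactionNorm; positivity
    have hLs : 0 ≤ MinwiseHashing.Lstar n q θ Θ := mul_nonneg (Real.sqrt_nonneg _) hℓ
    rw [Real.sqrt_one, one_mul]
    gcongr
    -- For `c = 1` the general bound has `L*/(4L)` without the factor `√2`, which is only added
    -- here.
    exact le_mul_of_one_le_left hLs (Real.one_le_sqrt.2 one_le_two)
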